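/- Let $n\ge 2$. Let $B_n$ be the hyperoctahedral group, i.e. the group of permutations $w$ of $\{\pm1,\dots,\pm n\}$ with $w(-i)=-w(i)$ for all $i$, with simple reflections $s_0=(1\ {-1})$ and $s_i=(i\ \ i{+}1)({-i}\ \ {-(i{+}1)})$ for $1\le i\le n-1$. Let $T$ be the set of all conjugates of simple reflections, let $\ell_T(w)$ be the least number of factors in an expression of $w$ as a product of elements of $T$, and let $\le_T$ be the absolute order: $u\le_T v$ if and only if $\ell_T(v)=\ell_T(u)+\ell_T(u^{-1}v)$. Let $c$ be a Coxeter element of $B_n$ (a product, in some order, of all the simple reflections, each taken once), and let $NC(B_n,c)=\{w: e\le_T w\le_T c\}$, which is a lattice under $\le_T$. For $w\in B_n$ let $\pi_T(w)$ be the join in $NC(B_n,c)$ of all $t\in T$ with $t\le_T w$, and let $\mathrm{Pop}_T(w)=w\cdot\pi_T(w)^{-1}$. Then the number of elements $w\in B_n$ that require exactly $2n-2$ or exactly $2n-1$ iterations of $\mathrm{Pop}_T$ to reach the identity (that is, for which the least $k\ge 0$ with $\mathrm{Pop}_T^k(w)=e$ is $2n-2$ or $2n-1$) is $2^n-n$.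 -/

import Mathlib

namespace PopTsack

section Dual

variable {W : Type*} [Group W]

/-- The set `T` of reflections of `(W, S)`: the closure of `S` under conjugation. -/
def reflections (S : Set W) : Set W :=
  {t | ∃ w : W, ∃ s ∈ S, t = w * s * w⁻¹}

/-- The absolute (reflection) length `ℓ_T(w)`: the least number of factors in an expression of `w`
as a product of reflections. -/
noncomputable def absLength (S : Set W) (w : W) : ℕ :=
  sInf {k | ∃ l : List W, (∀ t ∈ l, t ∈ reflections S) ∧ l.length = k ∧ l.prod = w}

/-- The absolute order: `u ≤_T v` if and only if `ℓ_T(v) = ℓ_T(u) + ℓ_T(u⁻¹ v)`. -/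
def AbsLE (S : Set W) (u v : W) : Prop :=
  absLength S v = absLength S u + absLength S (u⁻¹ * v)

/-- The noncrossing partitions `NC(W, c)`: the interval `[e, c]` of the absolute order. -/
def noncrossing (S : Set W) (c : W) : Set W :=
  {w | AbsLE S 1 w ∧ AbsLE S w c}

/-- `v` is the join of the set `A` in the poset `NC(W, c)`, i.e. its least upper bound there. -/
def IsNCJoin (S : Set W) (c : W) (A : Set W) (v : W) : Prop :=
  v ∈ noncrossing S c ∧ (∀ a ∈ A, AbsLE S a v) ∧
    ∀ u ∈ noncrossing S c, (∀ a ∈ A, AbsLE S a u) → AbsLE S v u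

/-- The reflections lying below `w` in the absolute order. -/
def reflectionsBelow (S : Set W) (w : W) : Set W :=
  {t | t ∈ reflections S ∧ AbsLE S t w}

open Classical in
/-- The noncrossing projection `π_T(w)`: the join in `NC(W, c)` of all reflections `t ≤_T w`.
(For a finite Coxeter group and a Coxeter element `c` the poset `NC(W, c)` is a lattice, so this
join exists and the value `1` in the other case is never taken.) -/
noncomputable def ncProj (S : Set W) (c w : W) : W :=
  if h : ∃ v, IsNCJoin S c (reflectionsBelow S w) v then h.choose else 1

/-- The Coxeter pop-tsack torsing operator `Pop_T(w) = w · π_T(w)⁻¹`. -/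
noncomputable def popT (S : Set W) (c w : W) : W :=
  w * (ncProj S c w)⁻¹

/-- `w` requires exactly `k` iterations of `Pop_T` to reach the identity. -/
def RequiresExactly (S : Set W) (c w : W) (k : ℕ) : Prop :=
  IsLeast {m : ℕ | (popT S c)^[m] w = 1} k

end Dual

section TypeB

/-- The set `±[n]`: `(i, false)` stands for the number `i + 1` and `(i, true)` for its
negative. -/
abbrev SignedPoint (n : ℕ) : Type := Fin n × Bool

/-- Negation on `±[n]`. -/
def bar {n : ℕ} (x : SignedPoint n) : SignedPoint n := (x.1, !x.2)

/-- The hyperoctahedral group `B_n`: the permutations `w` of `±[n]` with `w(-x) = -w(x)`. -/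
def Hyperoctahedral (n : ℕ) : Subgroup (Equiv.Perm (SignedPoint n)) where
  carrier := {w | ∀ x, w (bar x) = bar (w x)}
  one_mem' := fun _ => rfl
  mul_mem' := by
    intro a b ha hb x
    change ∀ x, a (bar x) = bar (a x) at ha
    change ∀ x, b (bar x) = bar (b x) at hb
    change (a * b) (bar x) = bar ((a * b) x)
    rw [Equiv.Perm.mul_apply, Equiv.Perm.mul_apply, hb, ha]
  inv_mem' := by
    intro a ha x
    change ∀ x, a (bar x) = bar (a x) at ha
    change a⁻¹ (bar x) = bar (a⁻¹ x)
    rw [Equiv.Perm.inv_eq_iff_eq, ha]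
    simp

/-- The signed permutation induced by a permutation of `[n]`. -/
def liftPerm {n : ℕ} (p : Equiv.Perm (Fin n)) : Hyperoctahedral n :=
  ⟨p.prodCongr (Equiv.refl Bool), fun _ => rfl⟩

/-- The sign change `(i, -i)`. -/
def signChange {n : ℕ} (i : Fin n) : Hyperoctahedral n :=
  ⟨Equiv.swap (i, false) (i, true), by
    rintro ⟨j, b⟩
    by_cases h : j = i
    · subst h
      cases b <;> simp [bar]
    · rw [Equiv.swap_apply_of_ne_of_ne, Equiv.swap_apply_of_ne_of_ne] <;> simp [bar, h]⟩

/-- The simple reflections `s_0 = (1, -1)` and `s_i = (i, i+1)(-i, -(i+1))`, `1 ≤ i < n`,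
of `B_n`. -/
def simpleReflection {n : ℕ} (i : Fin n) : Hyperoctahedral n :=
  if (i : ℕ) = 0 then signChange i
  else liftPerm (Equiv.swap ⟨(i : ℕ) - 1, lt_of_le_of_lt (Nat.sub_le _ _) i.isLt⟩ i)

/-- The set `S` of simple reflections of `B_n`. -/
def simpleReflections (n : ℕ) : Set (Hyperoctahedral n) :=
  Set.range (simpleReflection (n := n))

/-- A Coxeter element of `B_n`: the product, in some order, of all the simple reflections, each
taken once. -/
def IsCoxeterElement {n : ℕ} (c : Hyperoctahedral n) : Prop :=
  ∃ σ : Equiv.Perm (Fin n), c = (List.ofFn fun i => simpleReflection (σ i)).prod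

end TypeB

end PopTsack

/-!
A Coxeter element `c` of `B_n` permutes `±[n]` in a single cycle of length `2 n`, so the signed
permutations become the permutations of `ZMod (2 * n)` that commute with the half turn `x ↦ x + n`,
and `c` becomes the rotation `x ↦ x + 1`. In this picture `π_T(w)` maps every point to the next
point of its class in the finest noncrossing equivalence relation whose classes contain the cycles
of `w`; that it is the join of the reflections below `w` follows from Carter's lemma, which turns
the absolute order into an inclusion of subspaces of `ℝⁿ`.

Going forward from `x` to `w x`, one meets `π_T(w) x` on the way. Hence each iteration lowers the
winding number of `w`, the total length of the arcs from `x` to `w x` divided by `2 n`, by the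
winding number of `π_T(w)`, which is positive unless `w = 1`. The winding number is at most
`2 n - 1`, so a `w` that needs more than `2 n - 3` iterations has winding number at least
`2 n - 2`. Then `(c w)⁻¹` has winding number at most `1`, which means that it cyclically permutes a
set `A = -A` in increasing order and fixes the other points. The first iterations for such a `w`
lower the winding number only by `1`, unless `A` is a pair of antipodal points. There are `2 ^ n`
sets `A = -A`, of which `n` are antipodal pairs.
-/

namespace PopTsack

/-! ### Carter's lemma and the absolute order -/

section MovedSpace

variable {V : Type*} [NormedAddCommGroup V] [InnerProductSpace ℝ V] {g h : V ≃ₗᵢ[ℝ] V} {v x : V}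

/-- The moved space `(g - 1) V` of a linear isometry `g`. Its dimension computes the absolute
length in a reflection group. -/
def movedSpace (g : V ≃ₗᵢ[ℝ] V) : Submodule ℝ V :=
  LinearMap.range ((g.toLinearEquiv : V →ₗ[ℝ] V) - LinearMap.id)

theorem mem_movedSpace : v ∈ movedSpace g ↔ ∃ y, g y - y = v := Iff.rfl

theorem sub_mem_movedSpace (g : V ≃ₗᵢ[ℝ] V) (x : V) : g x - x ∈ movedSpace g := ⟨x, rfl⟩

theorem movedSpace_le {M : Submodule ℝ V} : movedSpace g ≤ M ↔ ∀ x, g x - x ∈ M :=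
  ⟨fun hg x => hg (sub_mem_movedSpace g x), by rintro hg _ ⟨x, rfl⟩; exact hg x⟩

theorem movedSpace_mul_le (g h : V ≃ₗᵢ[ℝ] V) :
    movedSpace (g * h) ≤ movedSpace g ⊔ movedSpace h := by
  refine movedSpace_le.2 fun x => ?_
  rw [LinearIsometryEquiv.coe_mul, Function.comp_apply, ← sub_add_sub_cancel]
  exact Submodule.add_mem_sup (sub_mem_movedSpace g (h x)) (sub_mem_movedSpace h x)

theorem movedSpace_inv (g : V ≃ₗᵢ[ℝ] V) : movedSpace g⁻¹ = movedSpace g := by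
  have movedSpace_inv_le (k : V ≃ₗᵢ[ℝ] V) : movedSpace k⁻¹ ≤ movedSpace k := by
    refine movedSpace_le.2 fun x => ?_
    have hx : k (k⁻¹ x) = x := k.apply_symm_apply x
    rw [← neg_sub]
    exact neg_mem (by simpa only [hx] using sub_mem_movedSpace k (k⁻¹ x))
  exact (movedSpace_inv_le g).antisymm (by simpa only [inv_inv] using movedSpace_inv_le g⁻¹)

theorem movedSpace_eq_bot : movedSpace g = ⊥ ↔ g = 1 := by
  simp only [← le_bot_iff, movedSpace_le, Submodule.mem_bot, sub_eq_zero]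
  exact ⟨fun hg => LinearIsometryEquiv.ext hg, by rintro rfl x; rfl⟩

theorem mem_orthogonal_movedSpace : x ∈ (movedSpace g)ᗮ ↔ g x = x := by
  constructor
  · intro hx
    have hinner : inner ℝ (g x) x = inner ℝ x x := by
      simpa only [inner_sub_left, sub_eq_zero] using hx _ (sub_mem_movedSpace g x)
    rw [← sub_eq_zero, ← inner_self_eq_zero (𝕜 := ℝ), inner_sub_sub_self, g.inner_map_map,
      real_inner_comm (g x) x, hinner]
    ring
  · rintro hx _ ⟨y, rfl⟩
    change inner ℝ (g y - y) x = 0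
    rw [inner_sub_left, sub_eq_zero, ← g.inner_map_map y x, hx]

theorem movedSpace_reflection (v : V) : movedSpace (ℝ ∙ v)ᗮ.reflection = ℝ ∙ v := by
  refine le_antisymm (movedSpace_le.2 fun x => ?_) ?_
  · rw [Submodule.reflection_orthogonal_apply, Submodule.reflection_apply, neg_sub,
      sub_sub_cancel_left]
    exact neg_mem (nsmul_mem (Submodule.starProjection_apply_mem _ x) 2)
  · rw [Submodule.span_singleton_le_iff_mem]
    have hv := sub_mem_movedSpace (ℝ ∙ v)ᗮ.reflection v
    rw [Submodule.reflection_orthogonalComplement_singleton_eq_neg] at hv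
    convert Submodule.smul_mem _ (-(1 / 2) : ℝ) hv using 1
    module

/-- Carter's lemma. If `v = g y - y`, then the reflection in `v` sends `g y` back to `y`, so the
product has the new fixed vector `y`. -/
theorem movedSpace_reflection_mul_lt (hv : v ≠ 0) (hg : v ∈ movedSpace g) :
    movedSpace ((ℝ ∙ v)ᗮ.reflection * g) < movedSpace g := by
  obtain ⟨y, hy⟩ := mem_movedSpace.1 hg
  refine lt_of_le_of_ne ((movedSpace_mul_le _ _).trans (sup_le ?_ le_rfl)) fun heq => hv ?_
  · rwa [movedSpace_reflection, Submodule.span_singleton_le_iff_mem]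
  · have hfix : ((ℝ ∙ v)ᗮ.reflection * g) y = y := by
      rw [LinearIsometryEquiv.coe_mul, Function.comp_apply, ← hy]
      exact Submodule.reflection_sub (g.norm_map y)
    rw [← mem_orthogonal_movedSpace, heq, mem_orthogonal_movedSpace] at hfix
    rw [← hy, hfix, sub_self]

theorem movedSpace_mul_reflection_lt (hv : v ≠ 0) (hg : v ∈ movedSpace g) :
    movedSpace (g * (ℝ ∙ v)ᗮ.reflection) < movedSpace g := by
  rw [← movedSpace_inv g] at hg ⊢
  rw [← movedSpace_inv, mul_inv_rev, Submodule.reflection_inv]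
  exact movedSpace_reflection_mul_lt hv hg

theorem finrank_movedSpace_mul_le [FiniteDimensional ℝ V] (g h : V ≃ₗᵢ[ℝ] V) :
    Module.finrank ℝ (movedSpace (g * h)) ≤
      Module.finrank ℝ (movedSpace g) + Module.finrank ℝ (movedSpace h) :=
  (Submodule.finrank_mono (movedSpace_mul_le g h)).trans
    (Submodule.finrank_add_le_finrank_add_finrank _ _)

end MovedSpace

section AbsoluteOrder

variable {W : Type*} [Group W] {S : Set W}

theorem one_absLE (w : W) : AbsLE S 1 w := by
  have absLength_one : absLength S (1 : W) = 0 := Nat.sInf_eq_zero.2 (Or.inl ⟨[], by simp⟩)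
  rw [AbsLE, absLength_one, inv_one, one_mul, zero_add]

variable {V : Type*} [NormedAddCommGroup V] [InnerProductSpace ℝ V] {ρ : W →* (V ≃ₗᵢ[ℝ] V)}
  {s t u v w : W}

/-- A faithful representation `ρ` of `(W, S)` on a Euclidean space in which the elements of
`reflections S` act by orthogonal reflections, and in which the moved space of every nontrivial
element contains the root of one of them. Such a representation computes the absolute length. -/
structure IsReflectionRep (S : Set W) (ρ : W →* (V ≃ₗᵢ[ℝ] V)) : Prop where
  injective : Function.Injective ρ
  exists_root : ∀ t ∈ reflections S, ∃ v : V, v ≠ 0 ∧ ρ t = (ℝ ∙ v)ᗮ.reflection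
  exists_reflection : ∀ w, w ≠ 1 → ∃ t ∈ reflections S, movedSpace (ρ t) ≤ movedSpace (ρ w)

namespace IsReflectionRep

theorem movedSpace_eq_bot (hρ : IsReflectionRep S ρ) : movedSpace (ρ w) = ⊥ ↔ w = 1 := by
  rw [PopTsack.movedSpace_eq_bot, map_eq_one_iff ρ hρ.injective]

theorem reflection_mul_self (hρ : IsReflectionRep S ρ) (ht : t ∈ reflections S) : t * t = 1 := by
  obtain ⟨v, -, hv⟩ := hρ.exists_root t ht
  exact hρ.injective (by rw [map_mul, map_one, hv, Submodule.reflection_mul_reflection])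

theorem reflection_inv (hρ : IsReflectionRep S ρ) (ht : t ∈ reflections S) : t⁻¹ = t :=
  inv_eq_of_mul_eq_one_left (hρ.reflection_mul_self ht)

theorem movedSpace_mul_reflection_lt (hρ : IsReflectionRep S ρ) (ht : t ∈ reflections S)
    (hle : movedSpace (ρ t) ≤ movedSpace (ρ w)) :
    movedSpace (ρ (w * t)) < movedSpace (ρ w) := by
  obtain ⟨v, hv0, hv⟩ := hρ.exists_root t ht
  rw [hv, movedSpace_reflection, Submodule.span_singleton_le_iff_mem] at hle
  rw [map_mul, hv]
  exact PopTsack.movedSpace_mul_reflection_lt hv0 hle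

theorem movedSpace_reflection_mul_lt (hρ : IsReflectionRep S ρ) (ht : t ∈ reflections S)
    (hle : movedSpace (ρ t) ≤ movedSpace (ρ w)) :
    movedSpace (ρ (t * w)) < movedSpace (ρ w) := by
  obtain ⟨v, hv0, hv⟩ := hρ.exists_root t ht
  rw [hv, movedSpace_reflection, Submodule.span_singleton_le_iff_mem] at hle
  rw [map_mul, hv]
  exact PopTsack.movedSpace_reflection_mul_lt hv0 hle

theorem finrank_movedSpace_reflection (hρ : IsReflectionRep S ρ) (ht : t ∈ reflections S) :
    Module.finrank ℝ (movedSpace (ρ t)) = 1 := by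
  obtain ⟨v, hv0, hv⟩ := hρ.exists_root t ht
  rw [hv, movedSpace_reflection, finrank_span_singleton hv0]

variable [FiniteDimensional ℝ V]

theorem exists_reflection_factorization (hρ : IsReflectionRep S ρ) (w : W) :
    ∃ l : List W, (∀ t ∈ l, t ∈ reflections S) ∧
      l.length ≤ Module.finrank ℝ (movedSpace (ρ w)) ∧ l.prod = w := by
  induction hk : Module.finrank ℝ (movedSpace (ρ w)) using Nat.strong_induction_on generalizing w
  with | _ k ih =>
  obtain rfl | hw := eq_or_ne w 1
  · exact ⟨[], by simp⟩
  · obtain ⟨t, ht, hle⟩ := hρ.exists_reflection w hw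
    have hlt := Submodule.finrank_lt_finrank_of_lt (hρ.movedSpace_reflection_mul_lt ht hle)
    obtain ⟨l, hl, hlen, hprod⟩ := ih _ (hk ▸ hlt) (t * w) rfl
    refine ⟨t :: l, List.forall_mem_cons.2 ⟨ht, hl⟩, ?_, ?_⟩
    · rw [List.length_cons]
      lia
    · rw [List.prod_cons, hprod, ← mul_assoc, hρ.reflection_mul_self ht, one_mul]

theorem finrank_movedSpace_prod_le (hρ : IsReflectionRep S ρ) {l : List W}
    (hl : ∀ t ∈ l, t ∈ reflections S) :
    Module.finrank ℝ (movedSpace (ρ l.prod)) ≤ l.length := by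
  induction l with
  | nil => rw [List.prod_nil, hρ.movedSpace_eq_bot.2 rfl, finrank_bot]; exact zero_le
  | cons t l ih =>
    obtain ⟨ht, hl⟩ := List.forall_mem_cons.1 hl
    calc Module.finrank ℝ (movedSpace (ρ (t :: l).prod))
        ≤ Module.finrank ℝ (movedSpace (ρ t)) + Module.finrank ℝ (movedSpace (ρ l.prod)) := by
          rw [List.prod_cons, map_mul]
          exact finrank_movedSpace_mul_le _ _
      _ ≤ 1 + l.length := add_le_add (hρ.finrank_movedSpace_reflection ht).le (ih hl)
      _ = (t :: l).length := by rw [List.length_cons, add_comm]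

theorem absLength_eq_finrank (hρ : IsReflectionRep S ρ) (w : W) :
    absLength S w = Module.finrank ℝ (movedSpace (ρ w)) := by
  obtain ⟨l, hl, hlen, hprod⟩ := hρ.exists_reflection_factorization w
  have hmem : l.length ∈ {k | ∃ l : List W, (∀ t ∈ l, t ∈ reflections S) ∧ l.length = k ∧
    l.prod = w} := ⟨l, hl, rfl, hprod⟩
  refine le_antisymm ((Nat.sInf_le hmem).trans hlen) (le_csInf ⟨_, hmem⟩ ?_)
  rintro _ ⟨l, hl, rfl, rfl⟩
  exact hρ.finrank_movedSpace_prod_le hl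

theorem absLength_mul_le (hρ : IsReflectionRep S ρ) (u v : W) :
    absLength S (u * v) ≤ absLength S u + absLength S v := by
  simp only [hρ.absLength_eq_finrank]
  rw [map_mul]
  exact finrank_movedSpace_mul_le _ _

theorem absLength_eq_zero (hρ : IsReflectionRep S ρ) : absLength S w = 0 ↔ w = 1 := by
  rw [hρ.absLength_eq_finrank, Submodule.finrank_eq_zero, hρ.movedSpace_eq_bot]

theorem absLength_reflection (hρ : IsReflectionRep S ρ) (ht : t ∈ reflections S) :
    absLength S t = 1 := by
  rw [hρ.absLength_eq_finrank, hρ.finrank_movedSpace_reflection ht]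

theorem absLE_refl (hρ : IsReflectionRep S ρ) (w : W) : AbsLE S w w := by
  rw [AbsLE, inv_mul_cancel, hρ.absLength_eq_zero.2 rfl, add_zero]

theorem absLE_antisymm (hρ : IsReflectionRep S ρ) (huv : AbsLE S u v) (hvu : AbsLE S v u) :
    u = v := by
  rw [AbsLE] at huv hvu
  exact inv_mul_eq_one.1 (hρ.absLength_eq_zero.1 (by lia : absLength S (u⁻¹ * v) = 0))

theorem absLE_trans (hρ : IsReflectionRep S ρ) (huv : AbsLE S u v) (hvw : AbsLE S v w) :
    AbsLE S u w := by
  rw [AbsLE] at *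
  have hquot := hρ.absLength_mul_le (u⁻¹ * v) (v⁻¹ * w)
  have hw := hρ.absLength_mul_le u (u⁻¹ * w)
  rw [mul_inv_cancel_left] at hw
  rw [mul_assoc, mul_inv_cancel_left] at hquot
  lia

theorem movedSpace_eq_sup (hρ : IsReflectionRep S ρ) (huv : AbsLE S u v) :
    movedSpace (ρ v) = movedSpace (ρ u) ⊔ movedSpace (ρ (u⁻¹ * v)) := by
  rw [AbsLE, hρ.absLength_eq_finrank, hρ.absLength_eq_finrank, hρ.absLength_eq_finrank] at huv
  have hle := movedSpace_mul_le (ρ u) (ρ (u⁻¹ * v))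
  rw [← map_mul, mul_inv_cancel_left] at hle
  exact Submodule.eq_of_le_of_finrank_le hle
    (huv ▸ Submodule.finrank_add_le_finrank_add_finrank _ _)

theorem movedSpace_mono (hρ : IsReflectionRep S ρ) (huv : AbsLE S u v) :
    movedSpace (ρ u) ≤ movedSpace (ρ v) :=
  hρ.movedSpace_eq_sup huv ▸ le_sup_left

theorem absLength_mul_reflection_lt (hρ : IsReflectionRep S ρ) (ht : t ∈ reflections S)
    (hle : movedSpace (ρ t) ≤ movedSpace (ρ w)) : absLength S (w * t) < absLength S w := by
  rw [hρ.absLength_eq_finrank, hρ.absLength_eq_finrank]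
  exact Submodule.finrank_lt_finrank_of_lt (hρ.movedSpace_mul_reflection_lt ht hle)

theorem reflection_absLE_iff (hρ : IsReflectionRep S ρ) (ht : t ∈ reflections S) :
    AbsLE S t w ↔ movedSpace (ρ t) ≤ movedSpace (ρ w) := by
  refine ⟨hρ.movedSpace_mono, fun hle => ?_⟩
  have hlt := Submodule.finrank_lt_finrank_of_lt (hρ.movedSpace_reflection_mul_lt ht hle)
  rw [← hρ.absLength_eq_finrank, ← hρ.absLength_eq_finrank] at hlt
  have hmul := hρ.absLength_mul_le t (t * w)
  rw [← mul_assoc, hρ.reflection_mul_self ht, one_mul, hρ.absLength_reflection ht] at hmul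
  rw [AbsLE, hρ.reflection_inv ht, hρ.absLength_reflection ht]
  lia

theorem mul_reflection_absLE (hρ : IsReflectionRep S ρ) (ht : t ∈ reflections S)
    (hle : AbsLE S t w) : AbsLE S (w * t) w := by
  have hlt := hρ.absLength_mul_reflection_lt ht (hρ.movedSpace_mono hle)
  have hmul := hρ.absLength_mul_le (w * t) t
  rw [mul_assoc, hρ.reflection_mul_self ht, mul_one, hρ.absLength_reflection ht] at hmul
  rw [AbsLE, mul_inv_rev, inv_mul_cancel_right, hρ.reflection_inv ht, hρ.absLength_reflection ht]
  lia

theorem exists_absLE_mul_reflection (hρ : IsReflectionRep S ρ) (huv : AbsLE S u v)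
    (hne : u ≠ v) :
    ∃ t ∈ reflections S, AbsLE S t v ∧ AbsLE S u (v * t) ∧ absLength S (v * t) < absLength S v := by
  obtain ⟨t, ht, hle⟩ := hρ.exists_reflection (u⁻¹ * v) (mt inv_mul_eq_one.1 hne)
  have htv : movedSpace (ρ t) ≤ movedSpace (ρ v) :=
    hle.trans (hρ.movedSpace_eq_sup huv ▸ le_sup_right)
  have hquot := hρ.absLength_mul_reflection_lt ht hle
  have hlt := hρ.absLength_mul_reflection_lt ht htv
  refine ⟨t, ht, (hρ.reflection_absLE_iff ht).2 htv, ?_, hlt⟩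
  have hvt := hρ.absLength_mul_le u (u⁻¹ * v * t)
  rw [← mul_assoc, mul_inv_cancel_left] at hvt
  have hv := hρ.absLength_mul_le (v * t) t
  rw [mul_assoc, hρ.reflection_mul_self ht, mul_one, hρ.absLength_reflection ht] at hv
  rw [AbsLE] at huv ⊢
  rw [← mul_assoc]
  lia

theorem ncProj_eq_of_isNCJoin (hρ : IsReflectionRep S ρ) {c : W}
    (hv : IsNCJoin S c (reflectionsBelow S w) v) : ncProj S c w = v := by
  have hex : ∃ v, IsNCJoin S c (reflectionsBelow S w) v := ⟨v, hv⟩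
  rw [ncProj, dif_pos hex]
  exact hρ.absLE_antisymm (hex.choose_spec.2.2 v hv.1 hv.2.1)
    (hv.2.2 _ hex.choose_spec.1 hex.choose_spec.2.1)

end IsReflectionRep

end AbsoluteOrder

/-! ### The hyperoctahedral group as a reflection group -/

section Hyperoctahedral

open scoped RealInnerProductSpace

variable {n : ℕ} {i j x y : SignedPoint n}

@[simp] theorem bar_bar (x : SignedPoint n) : bar (bar x) = x := by simp [bar]

theorem bar_ne (x : SignedPoint n) : bar x ≠ x := by simp [bar, Prod.ext_iff]

@[simp] theorem bar_inj : bar x = bar y ↔ x = y :=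
  (Function.Involutive.injective bar_bar).eq_iff

theorem bar_eq_iff : bar x = y ↔ x = bar y :=
  Function.Involutive.eq_iff bar_bar

theorem eq_or_eq_bar_of_fst_eq (h : x.1 = y.1) : x = y ∨ x = bar y := by
  obtain ⟨k, b⟩ := x
  obtain ⟨l, b'⟩ := y
  obtain rfl : k = l := h
  cases b <;> cases b' <;> simp [bar]

theorem Hyperoctahedral.apply_bar (w : Hyperoctahedral n) (x : SignedPoint n) :
    w.1 (bar x) = bar (w.1 x) := w.2 x

theorem Hyperoctahedral.ext {u v : Hyperoctahedral n} (h : ∀ x, u.1 x = v.1 x) : u = v :=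
  Subtype.ext (Equiv.ext h)

theorem Hyperoctahedral.mul_apply (u v : Hyperoctahedral n) (x : SignedPoint n) :
    (u * v).1 x = u.1 (v.1 x) := rfl

/-- The map underlying `signedSwap i j`. -/
def signedSwapFun (i j x : SignedPoint n) : SignedPoint n :=
  if x = i then j else if x = j then i else if x = bar i then bar j
    else if x = bar j then bar i else x

theorem signedSwapFun_involutive (i j : SignedPoint n) :
    Function.Involutive (signedSwapFun i j) := by
  intro x
  have hi := bar_ne i
  have hj := bar_ne j
  have hij : bar i = bar j ↔ i = j := bar_inj
  have hij' : bar i = j ↔ i = bar j := bar_eq_iff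
  unfold signedSwapFun
  grind

theorem signedSwapFun_bar (i j x : SignedPoint n) :
    signedSwapFun i j (bar x) = bar (signedSwapFun i j x) := by
  have hine := bar_ne i
  have hjne := bar_ne j
  have hi : bar x = i ↔ x = bar i := bar_eq_iff
  have hj : bar x = j ↔ x = bar j := bar_eq_iff
  have hi' : bar x = bar i ↔ x = i := bar_inj
  have hj' : bar x = bar j ↔ x = j := bar_inj
  have hii := bar_bar i
  have hjj := bar_bar j
  unfold signedSwapFun
  grind

/-- The reflection of `B_n` exchanging `i` with `j` and `bar i` with `bar j`; it is a sign change
if `j = bar i`. -/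
def signedSwap (i j : SignedPoint n) : Hyperoctahedral n :=
  ⟨(signedSwapFun_involutive i j).toPerm, signedSwapFun_bar i j⟩

theorem signedSwap_apply (i j x : SignedPoint n) :
    (signedSwap i j).1 x = if x = i then j else if x = j then i else if x = bar i then bar j
      else if x = bar j then bar i else x := rfl

@[simp] theorem signedSwap_apply_left (i j : SignedPoint n) : (signedSwap i j).1 i = j :=
  if_pos rfl

theorem signedSwap_apply_of_ne (hi : x ≠ i) (hj : x ≠ j) (hi' : x ≠ bar i) (hj' : x ≠ bar j) :
    (signedSwap i j).1 x = x := by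
  rw [signedSwap_apply, if_neg hi, if_neg hj, if_neg hi', if_neg hj']

theorem signedSwap_comm (i j : SignedPoint n) : signedSwap i j = signedSwap j i := by
  have hij : bar i = bar j ↔ i = j := bar_inj
  have hij' : bar i = j ↔ i = bar j := bar_eq_iff
  refine Hyperoctahedral.ext fun x => ?_
  rw [signedSwap_apply, signedSwap_apply]
  grind

theorem mul_signedSwap_mul_inv (w : Hyperoctahedral n) (i j : SignedPoint n) :
    w * signedSwap i j * w⁻¹ = signedSwap (w.1 i) (w.1 j) := by
  rw [mul_inv_eq_iff_eq_mul]
  refine Hyperoctahedral.ext fun x => ?_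
  simp only [Hyperoctahedral.mul_apply, signedSwap_apply, ← Hyperoctahedral.apply_bar,
    EmbeddingLike.apply_eq_iff_eq]
  split_ifs <;> rfl

theorem signChange_eq_signedSwap (i : Fin n) :
    signChange i = signedSwap (i, false) (bar (i, false)) := by
  refine Hyperoctahedral.ext fun x => ?_
  rw [signedSwap_apply, bar_bar]
  change Equiv.swap (i, false) (bar (i, false)) x = _
  rw [Equiv.swap_apply_def]
  split_ifs <;> rfl

theorem liftPerm_swap_eq_signedSwap (i j : Fin n) :
    liftPerm (Equiv.swap i j) = signedSwap (i, false) (j, false) := by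
  refine Hyperoctahedral.ext ?_
  rintro ⟨k, b⟩
  rw [signedSwap_apply]
  change (Equiv.swap i j k, b) = _
  rw [Equiv.swap_apply_def]
  cases b <;> simp only [bar, Prod.mk.injEq, and_true, and_false, Bool.not_false, reduceCtorEq,
    if_false] <;> split_ifs <;> rfl

theorem exists_apply_eq_apply_eq {a b i j : SignedPoint n} (hab : a ≠ b) (hab' : a ≠ bar b)
    (hij : i ≠ j) (hij' : i ≠ bar j) : ∃ w : Hyperoctahedral n, w.1 a = i ∧ w.1 b = j := by
  set s := signedSwap a i
  have hsa : s.1 a = i := signedSwap_apply_left a i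
  refine ⟨signedSwap (s.1 b) j * s, ?_, signedSwap_apply_left _ _⟩
  rw [Hyperoctahedral.mul_apply, hsa]
  refine signedSwap_apply_of_ne ?_ hij ?_ hij' <;> rw [← hsa]
  · exact s.1.injective.ne hab
  · rw [← Hyperoctahedral.apply_bar]
    exact s.1.injective.ne hab'

theorem exists_simpleReflection_eq_signedSwap (k : Fin n) :
    ∃ i j : SignedPoint n, i ≠ j ∧ simpleReflection k = signedSwap i j := by
  unfold simpleReflection
  split_ifs with hk
  · exact ⟨_, _, (bar_ne _).symm, signChange_eq_signedSwap k⟩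
  · refine ⟨_, _, fun h => ?_, liftPerm_swap_eq_signedSwap _ k⟩
    simp only [Prod.mk.injEq, and_true, Fin.ext_iff] at h
    lia

theorem signedSwap_bar_mem_reflections (i : SignedPoint n) :
    signedSwap i (bar i) ∈ reflections (simpleReflections n) := by
  let o : SignedPoint n := (⟨0, i.1.pos⟩, false)
  refine ⟨signedSwap o i, _, ⟨o.1, rfl⟩, ?_⟩
  rw [simpleReflection, if_pos rfl, signChange_eq_signedSwap, mul_signedSwap_mul_inv,
    Hyperoctahedral.apply_bar, signedSwap_apply_left]

theorem signedSwap_mem_reflections_of_ne (hij : i ≠ j) (hij' : i ≠ bar j) :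
    signedSwap i j ∈ reflections (simpleReflections n) := by
  have hfst : i.1 ≠ j.1 := fun h => (eq_or_eq_bar_of_fst_eq h).elim hij hij'
  have hn : 1 < n := by lia
  let p : SignedPoint n := (⟨0, i.1.pos⟩, false)
  let q : SignedPoint n := (⟨1, hn⟩, false)
  obtain ⟨w, hi, hj⟩ := exists_apply_eq_apply_eq (a := p) (b := q) (by simp [p, q])
    (by simp [p, q, bar]) hij hij'
  have hsimple : simpleReflection q.1 = signedSwap p q := by
    rw [simpleReflection, if_neg one_ne_zero]
    exact liftPerm_swap_eq_signedSwap p.1 q.1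
  exact ⟨w, _, ⟨q.1, rfl⟩, by rw [hsimple, mul_signedSwap_mul_inv, hi, hj]⟩

theorem mem_reflections_iff {t : Hyperoctahedral n} :
    t ∈ reflections (simpleReflections n) ↔ ∃ i j, i ≠ j ∧ t = signedSwap i j := by
  constructor
  · rintro ⟨w, _, ⟨k, rfl⟩, rfl⟩
    obtain ⟨i, j, hij, hk⟩ := exists_simpleReflection_eq_signedSwap k
    exact ⟨w.1 i, w.1 j, w.1.injective.ne hij, by rw [hk, mul_signedSwap_mul_inv]⟩
  · rintro ⟨i, j, hij, rfl⟩
    by_cases hij' : i = bar j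
    · rw [hij', signedSwap_comm]
      exact signedSwap_bar_mem_reflections j
    · exact signedSwap_mem_reflections_of_ne hij hij'

/-- The vector `±e_k` attached to the signed point `±k`. -/
noncomputable def signedVec (x : SignedPoint n) : EuclideanSpace ℝ (Fin n) :=
  EuclideanSpace.single x.1 (bif x.2 then -1 else 1)

theorem signedVec_bar (x : SignedPoint n) : signedVec (bar x) = -signedVec x := by
  obtain ⟨k, b⟩ := x
  ext l
  cases b <;> simp [signedVec, bar, apply_ite]

theorem inner_signedVec (x y : SignedPoint n) :
    ⟪signedVec x, signedVec y⟫ = (if x = y then 1 else 0) - if x = bar y then (1 : ℝ) else 0 := by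
  obtain ⟨k, b⟩ := x
  obtain ⟨l, b'⟩ := y
  cases b <;> cases b' <;> simp [signedVec, bar, EuclideanSpace.inner_single_left, apply_ite]

theorem norm_signedVec (x : SignedPoint n) : ‖signedVec x‖ = 1 := by
  obtain ⟨k, b⟩ := x
  cases b <;> simp [signedVec]

theorem signedVec_injective : Function.Injective (signedVec (n := n)) := by
  intro x y hxy
  have h := inner_signedVec x y
  rw [hxy, real_inner_self_eq_norm_sq, norm_signedVec] at h
  by_contra hne
  rw [if_neg hne] at h
  split_ifs at h <;> norm_num at h

theorem ext_signedVec {g h : EuclideanSpace ℝ (Fin n) ≃ₗᵢ[ℝ] EuclideanSpace ℝ (Fin n)}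
    (hgh : ∀ x, g (signedVec x) = h (signedVec x)) : g = h := by
  refine LinearIsometryEquiv.toLinearEquiv_injective (LinearEquiv.toLinearMap_injective ?_)
  refine (EuclideanSpace.basisFun (Fin n) ℝ).toBasis.ext fun k => ?_
  simpa [signedVec] using hgh (k, false)

theorem orthonormal_signedVec (w : Hyperoctahedral n) :
    Orthonormal ℝ fun k : Fin n => signedVec (w.1 (k, false)) := by
  rw [orthonormal_iff_ite]
  intro k l
  rw [inner_signedVec, ← Hyperoctahedral.apply_bar]
  simp [bar]

/-- The orthonormal basis `±e_{|w 1|}, …, ±e_{|w n|}` of `ℝⁿ`, the image of the standard basis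
under the signed permutation `w`. -/
noncomputable def signedBasis (w : Hyperoctahedral n) :
    OrthonormalBasis (Fin n) ℝ (EuclideanSpace ℝ (Fin n)) :=
  OrthonormalBasis.mk (orthonormal_signedVec w)
    ((orthonormal_signedVec w).linearIndependent.span_eq_top_of_card_eq_finrank'
      finrank_euclideanSpace.symm).ge

/-- The isometry of `ℝⁿ` sending `e_k` to `±e_l`, where `w k = ±l`. -/
noncomputable def signedIsometry (w : Hyperoctahedral n) :
    EuclideanSpace ℝ (Fin n) ≃ₗᵢ[ℝ] EuclideanSpace ℝ (Fin n) :=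
  (EuclideanSpace.basisFun (Fin n) ℝ).equiv (signedBasis w) (Equiv.refl _)

theorem signedIsometry_signedVec (w : Hyperoctahedral n) (x : SignedPoint n) :
    signedIsometry w (signedVec x) = signedVec (w.1 x) := by
  have hpos (k : Fin n) : signedIsometry w (signedVec (k, false)) = signedVec (w.1 (k, false)) := by
    simpa [signedIsometry, signedBasis, signedVec] using
      (EuclideanSpace.basisFun (Fin n) ℝ).equiv_apply_basis (signedBasis w) (Equiv.refl _) k
  obtain ⟨k, _ | _⟩ := x
  · exact hpos k
  · change signedIsometry w (signedVec (bar (k, false))) = signedVec (w.1 (bar (k, false)))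
    rw [signedVec_bar, map_neg, hpos, Hyperoctahedral.apply_bar, signedVec_bar]

/-- The action of `B_n` on `ℝⁿ` by signed permutations of the coordinates. -/
noncomputable def signedRep :
    Hyperoctahedral n →* (EuclideanSpace ℝ (Fin n) ≃ₗᵢ[ℝ] EuclideanSpace ℝ (Fin n)) where
  toFun := signedIsometry
  map_one' := ext_signedVec fun x => by rw [signedIsometry_signedVec]; rfl
  map_mul' u v := ext_signedVec fun x => by
    rw [LinearIsometryEquiv.coe_mul, Function.comp_apply]
    simp only [signedIsometry_signedVec, Hyperoctahedral.mul_apply]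

@[simp] theorem signedRep_signedVec (w : Hyperoctahedral n) (x : SignedPoint n) :
    signedRep w (signedVec x) = signedVec (w.1 x) :=
  signedIsometry_signedVec w x

theorem signedRep_signedSwap (i j : SignedPoint n) :
    signedRep (signedSwap i j) = (ℝ ∙ (signedVec j - signedVec i))ᗮ.reflection := by
  have hji : (ℝ ∙ (signedVec j - signedVec i))ᗮ.reflection (signedVec j) = signedVec i :=
    Submodule.reflection_sub (by rw [norm_signedVec, norm_signedVec])
  have hij : (ℝ ∙ (signedVec j - signedVec i))ᗮ.reflection (signedVec i) = signedVec j := by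
    simpa only [hji] using Submodule.reflection_reflection (ℝ ∙ (signedVec j - signedVec i))ᗮ
      (signedVec j)
  refine ext_signedVec fun x => ?_
  rw [signedRep_signedVec, signedSwap_apply]
  split_ifs with h₁ h₂ h₃ h₄
  · rw [h₁, hij]
  · rw [h₂, hji]
  · rw [h₃, signedVec_bar, signedVec_bar, map_neg, hij]
  · rw [h₄, signedVec_bar, signedVec_bar, map_neg, hji]
  · refine (Submodule.reflection_mem_subspace_eq_self ?_).symm
    rw [Submodule.mem_orthogonal_singleton_iff_inner_left, inner_sub_right, inner_signedVec,
      inner_signedVec, if_neg h₁, if_neg h₂, if_neg h₃, if_neg h₄, sub_self]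

theorem movedSpace_signedRep_signedSwap (i j : SignedPoint n) :
    movedSpace (signedRep (signedSwap i j)) = ℝ ∙ (signedVec j - signedVec i) := by
  rw [signedRep_signedSwap, movedSpace_reflection]

theorem signedVec_apply_sub_mem (w : Hyperoctahedral n) (x : SignedPoint n) :
    signedVec (w.1 x) - signedVec x ∈ movedSpace (signedRep w) := by
  simpa only [signedRep_signedVec] using sub_mem_movedSpace (signedRep w) (signedVec x)

theorem isReflectionRep_signedRep : IsReflectionRep (simpleReflections n) signedRep where
  injective u v huv := Hyperoctahedral.ext fun x => signedVec_injective <| by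
    rw [← signedRep_signedVec, huv, signedRep_signedVec]
  exists_root t ht := by
    obtain ⟨i, j, hij, rfl⟩ := mem_reflections_iff.1 ht
    exact ⟨_, sub_ne_zero.2 (signedVec_injective.ne hij.symm), signedRep_signedSwap i j⟩
  exists_reflection w hw := by
    obtain ⟨x, hx⟩ : ∃ x, w.1 x ≠ x := by
      by_contra! hfix
      exact hw (Hyperoctahedral.ext hfix)
    refine ⟨signedSwap x (w.1 x), mem_reflections_iff.2 ⟨_, _, hx.symm, rfl⟩, ?_⟩
    rw [movedSpace_signedRep_signedSwap, Submodule.span_singleton_le_iff_mem]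
    exact signedVec_apply_sub_mem w x

theorem signedSwap_absLE_iff {w : Hyperoctahedral n} (hij : i ≠ j) :
    AbsLE (simpleReflections n) (signedSwap i j) w ↔
      signedVec j - signedVec i ∈ movedSpace (signedRep w) := by
  rw [isReflectionRep_signedRep.reflection_absLE_iff (mem_reflections_iff.2 ⟨i, j, hij, rfl⟩),
    movedSpace_signedRep_signedSwap, Submodule.span_singleton_le_iff_mem]

theorem signedSwap_absLE_of_sameCycle {w : Hyperoctahedral n} (hij : i ≠ j)
    (h : w.1.SameCycle i j) : AbsLE (simpleReflections n) (signedSwap i j) w := by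
  rw [signedSwap_absLE_iff hij]
  obtain ⟨k, -, -, rfl⟩ := h.exists_pow_eq''
  clear h hij
  induction k with
  | zero => simp
  | succ k ih =>
    rw [pow_succ', Equiv.Perm.mul_apply, ← sub_add_sub_cancel]
    exact add_mem (signedVec_apply_sub_mem w _) ih

theorem inner_sum_signedVec (y : SignedPoint n) (s : Finset (SignedPoint n)) :
    ⟪signedVec y, ∑ z ∈ s, signedVec z⟫ =
      (if y ∈ s then 1 else 0) - if bar y ∈ s then (1 : ℝ) else 0 := by
  simp only [inner_sum, inner_signedVec, ← bar_eq_iff, Finset.sum_sub_distrib, Finset.sum_ite_eq]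

/-- The sum of the vectors `signedVec z` over a cycle of `w` is fixed by `w`, hence orthogonal to
its moved space. -/
theorem sameCycle_or_balanced_of_signedSwap_absLE {w : Hyperoctahedral n} (hij : i ≠ j)
    (h : AbsLE (simpleReflections n) (signedSwap i j) w) :
    w.1.SameCycle i j ∨ w.1.SameCycle i (bar i) ∧ w.1.SameCycle j (bar j) := by
  classical
  rw [signedSwap_absLE_iff hij] at h
  have hfix (k) : ∑ z with w.1.SameCycle k z, signedVec z ∈ (movedSpace (signedRep w))ᗮ := by
    rw [mem_orthogonal_movedSpace, map_sum]
    exact Finset.sum_equiv w.1 (by simp) (by simp)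
  have heq (k) := hfix k _ h
  simp only [inner_sub_left, inner_sum_signedVec, Finset.mem_filter, Finset.mem_univ, true_and]
    at heq
  by_contra! hcon
  have hi := heq i
  have hj := heq j
  rw [if_neg hcon.1, if_pos (Equiv.Perm.SameCycle.refl _ _)] at hi
  rw [if_neg (mt Equiv.Perm.SameCycle.symm hcon.1), if_pos (Equiv.Perm.SameCycle.refl _ _)] at hj
  by_cases hbal : w.1.SameCycle i (bar i)
  · rw [if_neg (hcon.2 hbal)] at hj
    split_ifs at hj <;> norm_num at hj
  · rw [if_neg hbal] at hi
    split_ifs at hi <;> norm_num at hi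

end Hyperoctahedral

/-! ### Noncrossing equivalence relations on a cycle -/

theorem rel_of_sameCycle {α : Type*} {r : Setoid α} {σ : Equiv.Perm α} (hσ : ∀ x, r x (σ x))
    {x y : α} (h : σ.SameCycle x y) : r x y := by
  obtain ⟨k, rfl⟩ := h
  induction k with
  | zero => exact r.refl' x
  | succ k ih => rw [add_comm, zpow_one_add]; exact r.trans' ih (hσ _)
  | pred k ih =>
    have hstep := hσ ((σ ^ (-(k : ℤ) - 1)) x)
    rw [← Equiv.Perm.mul_apply, ← zpow_one_add, add_sub_cancel] at hstep
    exact r.trans' ih (r.symm' hstep)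

section Cycle

variable {N : ℕ}

/-- The number of unit steps leading from `x` to `y` on the cycle `ZMod N`. -/
def arcLength (x y : ZMod N) : ℕ := (y - x).val

@[simp] theorem arcLength_self (x : ZMod N) : arcLength x x = 0 := by simp [arcLength]

@[simp] theorem arcLength_add_right (x y a : ZMod N) :
    arcLength (x + a) (y + a) = arcLength x y := by
  simp [arcLength]

theorem arcLength_eq_zero {x y : ZMod N} : arcLength x y = 0 ↔ x = y := by
  rw [arcLength, ZMod.val_eq_zero, sub_eq_zero, eq_comm]

theorem arcLength_add_natCast (x : ZMod N) {k : ℕ} (hk : k < N) :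
    arcLength x (x + (k : ZMod N)) = k := by
  simp [arcLength, ZMod.val_natCast, Nat.mod_eq_of_lt hk]

/-- An equivalence relation on the cycle `ZMod N` is noncrossing if, whenever `a, b, c, d` follow
one another along the cycle, `a ∼ c` and `b ∼ d` imply `a ∼ b`. -/
def IsNoncrossing (r : Setoid (ZMod N)) : Prop :=
  ∀ ⦃a b c d⦄, arcLength a b < arcLength a c → arcLength a c < arcLength a d →
    r a c → r b d → r a b

theorem IsNoncrossing.inf {r s : Setoid (ZMod N)} (hr : IsNoncrossing r) (hs : IsNoncrossing s) :
    IsNoncrossing (r ⊓ s) :=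
  fun _ _ _ _ hbc hcd hac hbd => ⟨hr hbc hcd hac.1 hbd.1, hs hbc hcd hac.2 hbd.2⟩

theorem IsNoncrossing.sInf {R : Set (Setoid (ZMod N))} (hR : ∀ r ∈ R, IsNoncrossing r) :
    IsNoncrossing (sInf R) :=
  fun _ _ _ _ hbc hcd hac hbd r hr => hR r hr hbc hcd (hac r hr) (hbd r hr)

/-- The finest noncrossing equivalence relation containing the cycles of `w`. -/
def ncOrbits (w : Equiv.Perm (ZMod N)) : Setoid (ZMod N) :=
  sInf {s | IsNoncrossing s ∧ ∀ x, s x (w x)}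

theorem isNoncrossing_ncOrbits (w : Equiv.Perm (ZMod N)) : IsNoncrossing (ncOrbits w) :=
  IsNoncrossing.sInf fun _ hs => hs.1

theorem rel_ncOrbits (w : Equiv.Perm (ZMod N)) (x : ZMod N) : ncOrbits w x (w x) :=
  fun _ hs => hs.2 x

theorem ncOrbits_le {w : Equiv.Perm (ZMod N)} {s : Setoid (ZMod N)} (hs : IsNoncrossing s)
    (h : ∀ x, s x (w x)) : ncOrbits w ≤ s :=
  fun _ _ hxy => hxy s ⟨hs, h⟩

/-- The equivalence relation whose two classes are the arc from `i + 1` to `j` and its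
complement. -/
def cut (i j : ZMod N) : Setoid (ZMod N) :=
  Setoid.ker fun x => arcLength (i + 1) x ≤ arcLength (i + 1) j

theorem cut_iff {i j x y : ZMod N} :
    cut i j x y ↔ (arcLength (i + 1) x ≤ arcLength (i + 1) j ↔
      arcLength (i + 1) y ≤ arcLength (i + 1) j) :=
  Setoid.ker_def.trans eq_iff_iff

/-- The equivalence relation whose only class with more than one element is `A`. -/
def block (A : Set (ZMod N)) : Setoid (ZMod N) where
  r x y := x = y ∨ x ∈ A ∧ y ∈ A
  iseqv := ⟨fun _ => Or.inl rfl, by grind, by grind⟩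

theorem block_iff {A : Set (ZMod N)} {x y : ZMod N} : block A x y ↔ x = y ∨ x ∈ A ∧ y ∈ A :=
  Iff.rfl

theorem isNoncrossing_block (A : Set (ZMod N)) : IsNoncrossing (block A) := by
  intro a b c d hbc hcd hac hbd
  rw [block_iff] at *
  rcases hac with rfl | hac
  · rw [arcLength_self] at hbc
    lia
  rcases hbd with rfl | hbd
  · lia
  · exact Or.inr ⟨hac.1, hbd.1⟩

theorem block_apply {w : Equiv.Perm (ZMod N)} (x : ZMod N) : block {x | w x ≠ x} x (w x) := by
  rw [block_iff, or_iff_not_imp_left]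
  exact fun hx => ⟨Ne.symm hx, fun h => hx (w.injective h).symm⟩

variable [NeZero N]

theorem arcLength_lt (x y : ZMod N) : arcLength x y < N := ZMod.val_lt _

theorem add_arcLength (x y : ZMod N) : x + (arcLength x y : ZMod N) = y := by
  simp [arcLength]

theorem arcLength_right_inj (o : ZMod N) {x y : ZMod N} :
    arcLength o x = arcLength o y ↔ x = y :=
  ⟨fun h => by rw [← add_arcLength o x, h, add_arcLength], fun h => h ▸ rfl⟩

theorem arcLength_eq_ite (o x y : ZMod N) :
    arcLength x y = if arcLength o x ≤ arcLength o y then arcLength o y - arcLength o x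
      else arcLength o y + N - arcLength o x := by
  have hx := arcLength_lt o x
  have hy := arcLength_lt o y
  have hsub : y - x = ((arcLength o y + N - arcLength o x : ℕ) : ZMod N) := by
    rw [Nat.cast_sub (by lia), Nat.cast_add, ZMod.natCast_self, arcLength, arcLength,
      ZMod.natCast_zmod_val, ZMod.natCast_zmod_val]
    ring
  rw [arcLength, hsub, ZMod.val_natCast]
  split_ifs with h
  · rw [show arcLength o y + N - arcLength o x = arcLength o y - arcLength o x + N by lia,
      Nat.add_mod_right, Nat.mod_eq_of_lt (by lia)]
  · exact Nat.mod_eq_of_lt (by lia)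

theorem arcLength_add_arcLength_add_one (x y : ZMod N) :
    arcLength x y + arcLength (y + 1) x + 1 = N := by
  have hy := arcLength_lt x y
  have hsub : x - (y + 1) = ((N - 1 - arcLength x y : ℕ) : ZMod N) := by
    rw [Nat.cast_sub (by lia), Nat.cast_sub (by lia), ZMod.natCast_self, arcLength,
      ZMod.natCast_zmod_val]
    push_cast
    ring
  rw [arcLength.eq_1 (y + 1), hsub, ZMod.val_natCast, Nat.mod_eq_of_lt (by lia)]
  lia

theorem arcLength_add_one_self (x : ZMod N) : arcLength (x + 1) x = N - 1 := by
  have := arcLength_add_arcLength_add_one x x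
  rw [arcLength_self] at this
  lia

theorem arcLength_add_one_left (o x y : ZMod N) :
    arcLength (x + 1) y = if arcLength o x < arcLength o y then arcLength o y - arcLength o x - 1
      else arcLength o y + N - arcLength o x - 1 := by
  have hyx := arcLength_add_arcLength_add_one y x
  rw [arcLength_eq_ite o y x] at hyx
  have := arcLength_lt o x
  have := arcLength_lt o y
  split_ifs at hyx ⊢ <;> lia

theorem exists_next (r : Setoid (ZMod N)) (x : ZMod N) :
    ∃ y, r x y ∧ ∀ z, r x z → arcLength (x + 1) y ≤ arcLength (x + 1) z :=
  Set.exists_min_image {y | r x y} (arcLength (x + 1)) (Set.toFinite _) ⟨x, r.refl' x⟩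

/-- The first element of the class of `x` met when walking along the cycle from `x + 1`; it is `x`
itself when the class is a singleton. -/
noncomputable def next (r : Setoid (ZMod N)) (x : ZMod N) : ZMod N := (exists_next r x).choose

theorem rel_next (r : Setoid (ZMod N)) (x : ZMod N) : r x (next r x) :=
  (exists_next r x).choose_spec.1

theorem arcLength_next_le {r : Setoid (ZMod N)} {x z : ZMod N} (h : r x z) :
    arcLength (x + 1) (next r x) ≤ arcLength (x + 1) z :=
  (exists_next r x).choose_spec.2 z h

theorem next_eq {r : Setoid (ZMod N)} {x y : ZMod N} (h : r x y)
    (hmin : ∀ z, r x z → arcLength (x + 1) y ≤ arcLength (x + 1) z) : next r x = y :=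
  (arcLength_right_inj (x + 1)).1 (le_antisymm (arcLength_next_le h) (hmin _ (rel_next r x)))

theorem next_eq_self_iff {r : Setoid (ZMod N)} {x : ZMod N} :
    next r x = x ↔ ∀ y, r x y → y = x := by
  refine ⟨fun h y hy => (arcLength_right_inj (x + 1)).1 ?_, fun h => h _ (rel_next r x)⟩
  have hle := arcLength_next_le hy
  have hlt := arcLength_lt (x + 1) y
  rw [h, arcLength_add_one_self] at hle
  rw [arcLength_add_one_self]
  lia

theorem next_injective (r : Setoid (ZMod N)) : Function.Injective (next r) := by
  intro x y hxy
  have hr : r x y := r.trans' (rel_next r x) (hxy ▸ r.symm' (rel_next r y))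
  have hx := arcLength_next_le hr
  have hy := arcLength_next_le (r.symm' hr)
  rw [← hxy] at hy
  rw [arcLength_add_one_left x] at hx hy
  rw [arcLength_add_one_left x y x] at hy
  rw [arcLength_add_one_left x x y] at hx
  have := arcLength_lt x y
  have := arcLength_lt x (next r x)
  rw [← arcLength_eq_zero]
  simp only [arcLength_self] at hx hy
  split_ifs at hx hy <;> lia

/-- The permutation sending every point to the next element of its class. -/
noncomputable def nextPerm (r : Setoid (ZMod N)) : Equiv.Perm (ZMod N) :=
  Equiv.ofBijective (next r) (Finite.injective_iff_bijective.1 (next_injective r))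

@[simp] theorem nextPerm_apply (r : Setoid (ZMod N)) (x : ZMod N) : nextPerm r x = next r x := rfl

theorem sameCycle_nextPerm_iff {r : Setoid (ZMod N)} {x y : ZMod N} :
    (nextPerm r).SameCycle x y ↔ r x y := by
  refine ⟨rel_of_sameCycle (rel_next r), fun h => ?_⟩
  induction hk : arcLength x y using Nat.strong_induction_on generalizing x with
  | _ k ih =>
    obtain rfl | hxy := eq_or_ne x y
    · rfl
    have hcloser : arcLength (next r x) y < k := by
      have hle := arcLength_next_le h
      have hpos : arcLength x y ≠ 0 := fun h => hxy (arcLength_eq_zero.1 h)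
      rw [arcLength_add_one_left x x y, arcLength_add_one_left x x (next r x)] at hle
      have := arcLength_eq_ite x (next r x) y
      have := arcLength_lt x y
      simp only [arcLength_self] at hle
      split_ifs at * <;> lia
    exact Equiv.Perm.sameCycle_apply_left.1
      (ih _ hcloser (r.trans' (r.symm' (rel_next r x)) h) rfl)

theorem IsNoncrossing.rel_of_lt {r : Setoid (ZMod N)} (hr : IsNoncrossing r) (o : ZMod N)
    {a b c d : ZMod N} (hab : arcLength o a < arcLength o b) (hbc : arcLength o b < arcLength o c)
    (hcd : arcLength o c < arcLength o d) (hac : r a c) (hbd : r b d) : r a b := by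
  refine hr ?_ ?_ hac hbd
  · rw [arcLength_eq_ite o a b, arcLength_eq_ite o a c, if_pos hab.le, if_pos (hab.trans hbc).le]
    lia
  · rw [arcLength_eq_ite o a c, arcLength_eq_ite o a d, if_pos (hab.trans hbc).le,
      if_pos (hab.trans (hbc.trans hcd)).le]
    lia

theorem isNoncrossing_cut (i j : ZMod N) : IsNoncrossing (cut i j) := by
  intro a b c d hbc hcd hac hbd
  rw [cut_iff] at *
  simp only [arcLength_eq_ite (i + 1) a] at hbc hcd
  have := arcLength_lt (i + 1) a
  have := arcLength_lt (i + 1) b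
  have := arcLength_lt (i + 1) c
  have := arcLength_lt (i + 1) d
  split_ifs at * <;> lia

theorem next_inf_cut_left {r : Setoid (ZMod N)} {i j : ZMod N} (hij : r i j) (hne : i ≠ j) :
    next (r ⊓ cut i j) i = next r j := by
  have hi := arcLength_add_one_self i
  have hj : arcLength (i + 1) j ≠ N - 1 := fun h =>
    hne ((arcLength_right_inj _).1 (hi.trans h.symm))
  have hjN := arcLength_lt (i + 1) j
  have hbefore := arcLength_next_le (r.symm' hij)
  simp only [arcLength_add_one_left (i + 1) j] at hbefore
  refine next_eq ⟨r.trans' hij (rel_next r j), cut_iff.2 ?_⟩ ?_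
  · split_ifs at hbefore <;> lia
  · rintro z ⟨hz, hside⟩
    have hle := arcLength_next_le (r.trans' (r.symm' hij) hz)
    simp only [arcLength_add_one_left (i + 1) j] at hle
    rw [cut_iff] at hside
    split_ifs at hle <;> lia

theorem next_inf_cut_right {r : Setoid (ZMod N)} {i j : ZMod N} (hij : r i j) :
    next (r ⊓ cut i j) j = next r i := by
  have hbefore := arcLength_next_le hij
  refine next_eq ⟨r.trans' (r.symm' hij) (rel_next r i), cut_iff.2 (by lia)⟩ ?_
  rintro z ⟨hz, hside⟩
  have hle := arcLength_next_le (r.trans' hij hz)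
  rw [cut_iff] at hside
  simp only [arcLength_add_one_left (i + 1) j]
  split_ifs <;> lia

theorem IsNoncrossing.cut_next {r : Setoid (ZMod N)} (hr : IsNoncrossing r) {i j x : ZMod N}
    (hij : r i j) (hxi : x ≠ i) (hxj : x ≠ j) : cut i j x (next r x) := by
  have hi := arcLength_add_one_self i
  have hpos {z w : ZMod N} (h : z ≠ w) : arcLength (i + 1) z ≠ arcLength (i + 1) w :=
    mt (arcLength_right_inj _).1 h
  have hx := arcLength_lt (i + 1) x
  have hy := arcLength_lt (i + 1) (next r x)
  have hxi' := hpos hxi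
  have hxj' := hpos hxj
  rw [cut_iff]
  by_cases hix : r i x
  · have hlei := arcLength_next_le (r.symm' hix)
    have hlej := arcLength_next_le (r.trans' (r.symm' hix) hij)
    simp only [arcLength_add_one_left (i + 1) x] at hlei hlej
    split_ifs at hlei hlej <;> lia
  · have hne {z : ZMod N} (hz : r i z) : next r x ≠ z := fun h =>
      hix (r.trans' hz (r.symm' (h ▸ rel_next r x)))
    have hyi := hpos (hne (r.refl' i))
    have hyj := hpos (hne hij)
    constructor <;> intro h <;> by_contra hcon
    · have hxj := hr.rel_of_lt (i + 1) (a := x) (b := j) (c := next r x) (d := i) (by lia) (by lia)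
        (by lia) (rel_next r x) (r.symm' hij)
      exact hix (r.trans' hij (r.symm' hxj))
    · have hyj := hr.rel_of_lt (i + 1) (a := next r x) (b := j) (c := x) (d := i) (by lia) (by lia)
        (by lia) (r.symm' (rel_next r x)) (r.symm' hij)
      exact hix (r.trans' hij (r.trans' (r.symm' hyj) (r.symm' (rel_next r x))))

theorem IsNoncrossing.nextPerm_mul_swap {r : Setoid (ZMod N)} (hr : IsNoncrossing r)
    {i j : ZMod N} (hij : r i j) (hne : i ≠ j) :
    nextPerm r * Equiv.swap i j = nextPerm (r ⊓ cut i j) := by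
  ext x : 1
  simp only [Equiv.Perm.mul_apply, nextPerm_apply]
  obtain rfl | hxi := eq_or_ne x i
  · rw [Equiv.swap_apply_left, next_inf_cut_left hij hne]
  obtain rfl | hxj := eq_or_ne x j
  · rw [Equiv.swap_apply_right, next_inf_cut_right hij]
  rw [Equiv.swap_apply_of_ne_of_ne hxi hxj]
  exact (next_eq (r := r ⊓ cut i j) ⟨rel_next r x, hr.cut_next hij hxi hxj⟩
      fun z hz => arcLength_next_le hz.1).symm

theorem next_ncOrbits_eq_self_iff {w : Equiv.Perm (ZMod N)} {x : ZMod N} :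
    next (ncOrbits w) x = x ↔ w x = x := by
  rw [next_eq_self_iff]
  refine ⟨fun h => h _ (rel_ncOrbits w x), fun hx y hxy => ?_⟩
  obtain h | h := ncOrbits_le (isNoncrossing_block _) block_apply hxy
  · exact h.symm
  · exact absurd hx h.1

theorem arcLength_next_le_arcLength {r : Setoid (ZMod N)} {x y : ZMod N} (h : r x y)
    (hne : x ≠ y) : arcLength x (next r x) ≤ arcLength x y := by
  have hle := arcLength_next_le h
  have hpos : arcLength x y ≠ 0 := fun h => hne (arcLength_eq_zero.1 h)
  simp only [arcLength_add_one_left x x, arcLength_self] at hle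
  split_ifs at hle <;> lia

theorem next_block_eq_self {A : Set (ZMod N)} {x : ZMod N} (hx : x ∉ A) : next (block A) x = x :=
  next_eq_self_iff.2 fun _ hy => hy.elim Eq.symm fun hy => absurd hy.1 hx

theorem setOf_nextPerm_block_ne {A : Set (ZMod N)} (hA : A.Subsingleton → A = ∅) :
    {x | nextPerm (block A) x ≠ x} = A := by
  ext x
  refine ⟨fun h => by_contra fun hx => h (next_block_eq_self hx), fun hx h => ?_⟩
  have hsub : A = {x} := Set.eq_singleton_iff_unique_mem.2
    ⟨hx, fun y hy => next_eq_self_iff.1 h y (Or.inr ⟨hx, hy⟩)⟩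
  exact Set.singleton_ne_empty x (hsub ▸ hA (hsub ▸ Set.subsingleton_singleton))

end Cycle

/-! ### Winding numbers of permutations of a cycle -/

section Winding

variable {N : ℕ}

/-- The rotation of the cycle by one step. -/
def rot : Equiv.Perm (ZMod N) := Equiv.addRight 1

@[simp] theorem rot_apply (x : ZMod N) : (rot : Equiv.Perm (ZMod N)) x = x + 1 := rfl

variable [NeZero N]

/-- The total number of unit steps that a permutation of the cycle makes, each point being moved
forwards. -/
def displacement (v : Equiv.Perm (ZMod N)) : ℕ := ∑ x, arcLength x (v x)

/-- The points `x` for which the arc from `x` to `v x` makes the step from `z` to `z + 1`. -/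
def arcsThrough (v : Equiv.Perm (ZMod N)) (z : ZMod N) : Finset (ZMod N) :=
  {x | arcLength x z < arcLength x (v x)}

/-- The number of times that the arcs from `x` to `v x` wind around the cycle in total, counted at
the step from `0` to `1`. -/
def winding (v : Equiv.Perm (ZMod N)) : ℕ := (arcsThrough v 0).card

@[simp] theorem mem_arcsThrough {v : Equiv.Perm (ZMod N)} {x z : ZMod N} :
    x ∈ arcsThrough v z ↔ arcLength x z < arcLength x (v x) := by
  simp [arcsThrough]

theorem sum_const_card (k : ℕ) : ∑ _x : ZMod N, k = N * k := by simp [ZMod.card]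

theorem sum_arcLength_add_sum_arcLength (z : ZMod N) :
    (∑ x, arcLength x z) + (∑ x, arcLength (z + 1) x) + N = N * N := by
  have hsum := Finset.sum_congr rfl fun x (_ : x ∈ Finset.univ) =>
    arcLength_add_arcLength_add_one x z
  simpa only [Finset.sum_add_distrib, sum_const_card, mul_one] using hsum

theorem mul_card_arcsThrough (v : Equiv.Perm (ZMod N)) (z : ZMod N) :
    N * (arcsThrough v z).card = displacement v := by
  have harc (x : ZMod N) : arcLength x z + arcLength (z + 1) (v x) + 1 +
      (if arcLength x z < arcLength x (v x) then N else 0) = arcLength x (v x) + N := by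
    have := arcLength_add_one_left x z (v x)
    have := arcLength_lt x z
    split_ifs at * <;> lia
  have hcover : ∑ x, (if arcLength x z < arcLength x (v x) then N else 0) =
      N * (arcsThrough v z).card := by
    rw [← Finset.sum_filter, Finset.sum_const, smul_eq_mul, mul_comm, arcsThrough]
  have hsum := Finset.sum_congr rfl fun x (_ : x ∈ Finset.univ) => harc x
  simp only [Finset.sum_add_distrib, sum_const_card, mul_one, hcover,
    Equiv.sum_comp v fun x => arcLength (z + 1) x, sum_arcLength_add_sum_arcLength] at hsum
  rw [displacement]
  lia

theorem mul_winding (v : Equiv.Perm (ZMod N)) : N * winding v = displacement v :=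
  mul_card_arcsThrough v 0

theorem card_arcsThrough (v : Equiv.Perm (ZMod N)) (z : ZMod N) :
    (arcsThrough v z).card = winding v :=
  Nat.eq_of_mul_eq_mul_left (NeZero.pos N) ((mul_card_arcsThrough v z).trans (mul_winding v).symm)

theorem winding_eq_zero_iff {v : Equiv.Perm (ZMod N)} : winding v = 0 ↔ v = 1 := by
  have hzero : winding v = 0 ↔ displacement v = 0 := by
    rw [← mul_winding, mul_eq_zero, or_iff_right (NeZero.ne N)]
  simp [hzero, displacement, arcLength_eq_zero, Equiv.ext_iff, eq_comm (b := v _)]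

theorem two_le_winding_iff {v : Equiv.Perm (ZMod N)} (z : ZMod N) :
    2 ≤ winding v ↔ ∃ x y, x ≠ y ∧ arcLength x z < arcLength x (v x) ∧
      arcLength y z < arcLength y (v y) := by
  rw [← card_arcsThrough v z, ← Nat.lt_iff_add_one_le, Finset.one_lt_card]
  simp only [mem_arcsThrough]
  grind

theorem eq_nextPerm_block_of_winding_le_one {v : Equiv.Perm (ZMod N)} (h : winding v ≤ 1) :
    v = nextPerm (block {x | v x ≠ x}) := by
  ext x : 1
  rw [nextPerm_apply]
  by_cases hx : v x = x
  · rw [next_block_eq_self (by simpa using hx), hx]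
  refine (next_eq (block_apply x) fun z hz => ?_).symm
  by_contra! hlt
  have hvz : v z ≠ z := by
    obtain rfl | hz := hz
    exacts [hx, hz.2]
  have hxz : x ≠ z := by
    rintro rfl
    have := arcLength_lt (x + 1) (v x)
    rw [arcLength_add_one_self] at hlt
    lia
  have hxz' := arcLength_eq_zero.not.2 hxz
  have hvx' := arcLength_eq_zero.not.2 (Ne.symm hx)
  have hvz' := arcLength_eq_zero.not.2 hvz.symm
  refine h.not_gt ((two_le_winding_iff z).2 ⟨x, z, hxz, ?_, ?_⟩)
  · simp only [arcLength_add_one_left x x, arcLength_self] at hlt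
    have := arcLength_lt x z
    split_ifs at hlt <;> lia
  · rw [arcLength_self]
    lia

theorem not_rel_of_arcs_meet {r : Setoid (ZMod N)} {x y z : ZMod N} (hxy : x ≠ y)
    (hx : arcLength x z < arcLength x (next r x)) (hy : arcLength y z < arcLength y (next r y)) :
    ¬ r x y := by
  intro hr
  have hlex := arcLength_next_le_arcLength hr hxy
  have hley := arcLength_next_le_arcLength (r.symm' hr) hxy.symm
  rw [arcLength_eq_ite x y x, arcLength_self] at hley
  rw [arcLength_eq_ite x y z] at hy
  split_ifs at hy hley <;> lia

theorem winding_nextPerm_le_one_of_le_block {r : Setoid (ZMod N)} {A : Set (ZMod N)}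
    (hA : ∀ x ∈ A, ∀ y ∈ A, r x y) (hr : r ≤ block A) : winding (nextPerm r) ≤ 1 := by
  by_contra! h
  obtain ⟨x, y, hxy, hx, hy⟩ := (two_le_winding_iff 0).1 h
  have hmem {x : ZMod N} (hx : arcLength x 0 < arcLength x (next r x)) : x ∈ A := by
    obtain heq | hA := hr (rel_next r x)
    · rw [← heq, arcLength_self] at hx
      lia
    · exact hA.1
  exact not_rel_of_arcs_meet hxy hx hy (hA x (hmem hx) y (hmem hy))

theorem winding_nextPerm_block_le_one (A : Set (ZMod N)) : winding (nextPerm (block A)) ≤ 1 :=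
  winding_nextPerm_le_one_of_le_block (fun _ hx _ hy => Or.inr ⟨hx, hy⟩) le_rfl

theorem winding_add_winding_inv (w : Equiv.Perm (ZMod N)) :
    winding w + winding (rot * w)⁻¹ + 1 = N := by
  have hinv : displacement (rot * w)⁻¹ = ∑ x, arcLength (w x + 1) x := by
    rw [displacement, ← Equiv.sum_comp (rot * w)]
    exact Finset.sum_congr rfl fun x _ => congrArg _ ((rot * w).symm_apply_apply x)
  have hsum := Finset.sum_congr rfl fun x (_ : x ∈ Finset.univ) =>
    arcLength_add_arcLength_add_one x (w x)
  simp only [Finset.sum_add_distrib, sum_const_card, mul_one, ← hinv] at hsum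
  apply Nat.eq_of_mul_eq_mul_left (NeZero.pos N)
  rw [← hsum, mul_add, mul_add, mul_winding, mul_winding, mul_one, displacement]

/-! ### The pop-tsack torsing operator on permutations of a cycle -/

/-- Division by the long cycles of the noncrossing closure of the orbits: this is `Pop_T` once the
Coxeter element is identified with `rot`. -/
noncomputable def popCycle (w : Equiv.Perm (ZMod N)) : Equiv.Perm (ZMod N) :=
  w * (nextPerm (ncOrbits w))⁻¹

theorem popCycle_next (w : Equiv.Perm (ZMod N)) (x : ZMod N) :
    popCycle w (next (ncOrbits w) x) = w x := by
  simp [popCycle, ← nextPerm_apply]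

theorem arcLength_next_add_arcLength (w : Equiv.Perm (ZMod N)) (x : ZMod N) :
    arcLength x (next (ncOrbits w) x) + arcLength (next (ncOrbits w) x) (w x) =
      arcLength x (w x) := by
  obtain hx | hx := eq_or_ne x (w x)
  · simp [next_ncOrbits_eq_self_iff.2 hx.symm, ← hx]
  · have hle := arcLength_next_le_arcLength (rel_ncOrbits w x) hx
    rw [arcLength_eq_ite x (next (ncOrbits w) x) (w x), if_pos hle]
    lia

theorem winding_nextPerm_add_winding_popCycle (w : Equiv.Perm (ZMod N)) :
    winding (nextPerm (ncOrbits w)) + winding (popCycle w) = winding w := by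
  apply Nat.eq_of_mul_eq_mul_left (NeZero.pos N)
  rw [mul_add, mul_winding, mul_winding, mul_winding, displacement, displacement, displacement,
    ← Equiv.sum_comp (nextPerm (ncOrbits w)) fun x => arcLength x (popCycle w x),
    ← Finset.sum_add_distrib]
  simp only [nextPerm_apply, popCycle_next, arcLength_next_add_arcLength]

theorem winding_nextPerm_ncOrbits_pos {w : Equiv.Perm (ZMod N)} (hw : w ≠ 1) :
    0 < winding (nextPerm (ncOrbits w)) := by
  rw [Nat.pos_iff_ne_zero, ne_eq, winding_eq_zero_iff]
  exact fun h => hw (Equiv.ext fun x => next_ncOrbits_eq_self_iff.1 (Equiv.ext_iff.1 h x))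

theorem popCycle_one : popCycle (1 : Equiv.Perm (ZMod N)) = 1 := by
  have h := winding_nextPerm_add_winding_popCycle (1 : Equiv.Perm (ZMod N))
  rw [winding_eq_zero_iff.2 rfl] at h
  exact winding_eq_zero_iff.1 (by lia)

theorem winding_popCycle_iterate_le (w : Equiv.Perm (ZMod N)) (m : ℕ) :
    winding (popCycle^[m] w) ≤ winding w - m := by
  induction m with
  | zero => rfl
  | succ m ih =>
    rw [Function.iterate_succ_apply']
    obtain hw | hw := eq_or_ne (popCycle^[m] w) 1
    · rw [hw, popCycle_one, winding_eq_zero_iff.2 rfl]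
      exact Nat.zero_le _
    · have hdrop := winding_nextPerm_add_winding_popCycle (popCycle^[m] w)
      have hpos := winding_nextPerm_ncOrbits_pos hw
      lia

end Winding

/-! ### Symmetric permutations of an even cycle -/

section Translation

variable {N : ℕ}

theorem commute_addRight_iff {w : Equiv.Perm (ZMod N)} {m : ZMod N} :
    Commute w (Equiv.addRight m) ↔ ∀ x, w (x + m) = w x + m :=
  Equiv.ext_iff

/-- Invariance of an equivalence relation under the translation by `m`. -/
def IsTranslationInvariant (m : ZMod N) (r : Setoid (ZMod N)) : Prop :=
  ∀ x y, r (x + m) (y + m) ↔ r x y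

theorem IsNoncrossing.comap_add_right {r : Setoid (ZMod N)} (hr : IsNoncrossing r) (m : ZMod N) :
    IsNoncrossing (r.comap (· + m)) :=
  fun _ _ _ _ hbc hcd hac hbd => hr (by simpa) (by simpa) hac hbd

theorem ncOrbits_le_comap_add_right {w : Equiv.Perm (ZMod N)} {m : ZMod N}
    (hw : Commute w (Equiv.addRight m)) : ncOrbits w ≤ (ncOrbits w).comap (· + m) :=
  ncOrbits_le ((isNoncrossing_ncOrbits w).comap_add_right m) fun x => by
    rw [Setoid.comap_rel, ← commute_addRight_iff.1 hw]
    exact rel_ncOrbits w _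

theorem isTranslationInvariant_ncOrbits {w : Equiv.Perm (ZMod N)} {m : ZMod N}
    (hw : Commute w (Equiv.addRight m)) : IsTranslationInvariant m (ncOrbits w) := by
  have hneg : Commute w (Equiv.addRight (-m)) := by simpa using hw.inv_right
  refine fun x y => ⟨fun h => ?_, fun h => ncOrbits_le_comap_add_right hw h⟩
  simpa [Setoid.comap_rel] using ncOrbits_le_comap_add_right hneg h

theorem isTranslationInvariant_block {A : Set (ZMod N)} {m : ZMod N}
    (hA : ∀ x, x + m ∈ A ↔ x ∈ A) : IsTranslationInvariant m (block A) := fun x y => by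
  simp only [block_iff, hA, add_left_inj]

theorem commute_rot_addRight (m : ZMod N) : Commute rot (Equiv.addRight m) :=
  commute_addRight_iff.2 fun x => add_right_comm x m 1

variable [NeZero N]

theorem IsTranslationInvariant.commute_nextPerm {m : ZMod N} {r : Setoid (ZMod N)}
    (hr : IsTranslationInvariant m r) : Commute (nextPerm r) (Equiv.addRight m) := by
  refine commute_addRight_iff.2 fun x => next_eq ((hr _ _).2 (rel_next r x)) fun z hz => ?_
  obtain ⟨z, rfl⟩ := add_right_surjective m z
  rw [add_right_comm, arcLength_add_right, arcLength_add_right]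
  exact arcLength_next_le ((hr _ _).1 hz)

theorem commute_popCycle {w : Equiv.Perm (ZMod N)} {m : ZMod N}
    (hw : Commute w (Equiv.addRight m)) : Commute (popCycle w) (Equiv.addRight m) :=
  hw.mul_left (isTranslationInvariant_ncOrbits hw).commute_nextPerm.inv_left

theorem commute_popCycle_iterate {w : Equiv.Perm (ZMod N)} {m : ZMod N}
    (hw : Commute w (Equiv.addRight m)) (k : ℕ) :
    Commute (popCycle^[k] w) (Equiv.addRight m) := by
  induction k with
  | zero => exact hw
  | succ k ih => exact Function.iterate_succ_apply' popCycle k w ▸ commute_popCycle ih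

theorem IsNoncrossing.arcLength_le_of_rel {r : Setoid (ZMod N)} (hr : IsNoncrossing r)
    {b p q : ZMod N} (hpq : r p q) (hp : arcLength (next r b) p ≤ arcLength (next r b) b) :
    arcLength (next r b) q ≤ arcLength (next r b) b := by
  by_contra! hq
  have hbq : ¬ r b q := fun h => by
    have hle := arcLength_next_le h
    have := arcLength_lt (next r b) q
    simp only [arcLength_add_one_left (next r b) b, arcLength_self] at hle
    split_ifs at hle <;> lia
  have hne {z : ZMod N} (hz : r b z) : p ≠ z := fun h => hbq (r.trans' hz (h ▸ hpq))
  have hpa := (arcLength_right_inj (next r b)).not.2 (hne (rel_next r b))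
  have hpb := (arcLength_right_inj (next r b)).not.2 (hne (r.refl' b))
  rw [arcLength_self] at hpa
  have hap := hr.rel_of_lt (next r b) (a := next r b) (b := p) (c := b) (d := q)
    (by rw [arcLength_self]; lia) (by lia) hq (r.symm' (rel_next r b)) hpq
  exact hbq (r.trans' (rel_next r b) (r.trans' hap hpq))

theorem exists_rel_arcLength_next_lt {r : Setoid (ZMod N)} {x z : ZMod N} (hxz : ¬ r x z) :
    ∃ b, r x b ∧ arcLength (next r b) b < arcLength (next r b) z := by
  obtain ⟨b, hxb, hmin⟩ := Set.exists_min_image {y | r x y} (arcLength · z) (Set.toFinite _)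
    ⟨x, r.refl' x⟩
  refine ⟨b, hxb, ?_⟩
  have hle := hmin (next r b) (r.trans' hxb (rel_next r b))
  have hbz : arcLength b z ≠ 0 := fun h => hxz (arcLength_eq_zero.1 h ▸ hxb)
  rw [arcLength_eq_ite (next r b) b z] at hle hbz
  have := arcLength_lt (next r b) b
  split_ifs at hle hbz <;> lia

end Translation

section Antipodal

variable {n : ℕ}

theorem half_add_half : (n : ZMod (2 * n)) + n = 0 := by
  rw [← two_mul]
  exact_mod_cast ZMod.natCast_self (2 * n)

variable [NeZero n]

theorem arcLength_antipode (x : ZMod (2 * n)) : arcLength x (x + n) = n :=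
  arcLength_add_natCast x (by have := NeZero.pos n; lia)

theorem IsNoncrossing.exists_short_arc {r : Setoid (ZMod (2 * n))} (hr : IsNoncrossing r)
    (hs : IsTranslationInvariant (n : ZMod (2 * n)) r) {x : ZMod (2 * n)} (hx : ¬ r x (x + n)) :
    ∃ b, r x b ∧ arcLength (next r b) b < n := by
  obtain ⟨b, hxb, hlt⟩ := exists_rel_arcLength_next_lt hx
  refine ⟨b, hxb, ?_⟩
  have hrel : r (next r b + n) (x + n) :=
    (hs _ _).2 (r.symm' (r.trans' hxb (rel_next r b)))
  by_contra! hle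
  exact hlt.not_ge (hr.arcLength_le_of_rel hrel ((arcLength_antipode _).trans_le hle))

theorem IsNoncrossing.rel_of_rel_antipode {r : Setoid (ZMod (2 * n))} (hr : IsNoncrossing r)
    {x y : ZMod (2 * n)} (hx : r x (x + n)) (hy : r y (y + n)) : r x y := by
  by_contra hxy
  have hn := arcLength_antipode y
  rw [arcLength_eq_ite x] at hn
  have hne {z w : ZMod (2 * n)} (hz : r x z) (hw : r y w) : arcLength x z ≠ arcLength x w :=
    fun h => hxy (r.trans' hz ((arcLength_right_inj x).1 h ▸ r.symm' hw))
  have h1 := hne (r.refl' x) (r.refl' y)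
  have h2 := hne (r.refl' x) hy
  have h3 := hne hx (r.refl' y)
  have h4 := hne hx hy
  rw [arcLength_self] at h1 h2
  rw [arcLength_antipode] at h3 h4
  have hylt := arcLength_lt x y
  have hynlt := arcLength_lt x (y + n)
  obtain hlt | hge := lt_or_ge (arcLength x y) n
  · refine hxy (hr ?_ ?_ hx hy) <;> rw [arcLength_antipode] <;> split_ifs at hn <;> lia
  · have hxyn : r x (y + n) := by
      refine hr ?_ ?_ hx (r.symm' hy) <;> rw [arcLength_antipode] <;> split_ifs at hn <;> lia
    exact hxy (r.trans' hxyn (r.symm' hy))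

theorem ncOrbits_rel_antipode {w : Equiv.Perm (ZMod (2 * n))}
    (hw : Commute w (Equiv.addRight (n : ZMod (2 * n)))) (hd : ∀ x, arcLength x (w x) ≤ n)
    {x y : ZMod (2 * n)} (hxy : ncOrbits w x y) (hne : x ≠ y) : ncOrbits w x (x + n) := by
  by_contra hx
  obtain ⟨b, hxb, hlt⟩ := (isNoncrossing_ncOrbits w).exists_short_arc
    (isTranslationInvariant_ncOrbits hw) hx
  have hwb : w b ≠ b := by
    rw [ne_eq, ← next_ncOrbits_eq_self_iff, next_eq_self_iff]
    intro h
    exact hne ((h x ((ncOrbits w).symm' hxb)).trans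
      (h y ((ncOrbits w).trans' ((ncOrbits w).symm' hxb) hxy)).symm)
  have hle := (isNoncrossing_ncOrbits w).arcLength_le_of_rel (rel_ncOrbits w b) le_rfl
  have hne' := (arcLength_right_inj (next (ncOrbits w) b)).not.2 hwb
  have hdb := hd b
  rw [arcLength_eq_ite (next (ncOrbits w) b) b] at hdb
  split_ifs at hdb <;> lia

theorem winding_nextPerm_ncOrbits_le_one {w : Equiv.Perm (ZMod (2 * n))}
    (hw : Commute w (Equiv.addRight (n : ZMod (2 * n)))) (hd : ∀ x, arcLength x (w x) ≤ n) :
    winding (nextPerm (ncOrbits w)) ≤ 1 := by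
  refine winding_nextPerm_le_one_of_le_block (A := {x | ncOrbits w x (x + n)})
    (fun x hx y hy => (isNoncrossing_ncOrbits w).rel_of_rel_antipode hx hy) fun {x y} hxy => ?_
  rw [block_iff, or_iff_not_imp_left]
  exact fun hne => ⟨ncOrbits_rel_antipode hw hd hxy hne,
    ncOrbits_rel_antipode hw hd ((ncOrbits w).symm' hxy) (Ne.symm hne)⟩

theorem arcLength_popCycle_le {N : ℕ} [NeZero N] {w : Equiv.Perm (ZMod N)} {k : ℕ}
    (h : ∀ x, arcLength x (w x) ≤ k) (x : ZMod N) : arcLength x (popCycle w x) ≤ k := by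
  obtain ⟨y, rfl⟩ := (nextPerm (ncOrbits w)).surjective x
  rw [nextPerm_apply, popCycle_next]
  have hadd := arcLength_next_add_arcLength w y
  have hy := h y
  lia

theorem winding_le_winding_popCycle_iterate_add {w : Equiv.Perm (ZMod (2 * n))}
    (hw : Commute w (Equiv.addRight (n : ZMod (2 * n)))) (hd : ∀ x, arcLength x (w x) ≤ n)
    (m : ℕ) : winding w ≤ winding (popCycle^[m] w) + m := by
  induction m generalizing w with
  | zero => rfl
  | succ m ih =>
    rw [Function.iterate_succ_apply]
    have hrest := ih (commute_popCycle hw) (arcLength_popCycle_le hd)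
    have hdrop := winding_nextPerm_add_winding_popCycle w
    have hone := winding_nextPerm_ncOrbits_le_one hw hd
    lia

end Antipodal

/-! ### Permutations with many iterations -/

section Slow

variable {N : ℕ} [NeZero N]

theorem arcLength_add_natCast_right {x y : ZMod N} {k : ℕ} (h : arcLength x y + k < N) :
    arcLength x (y + k) = arcLength x y + k := by
  simpa [← add_assoc, add_arcLength] using arcLength_add_natCast x h

theorem arcLength_add_one_right (x y : ZMod N) :
    arcLength x (y + 1) = 0 ∨ arcLength x (y + 1) = arcLength x y + 1 := by
  have hsum := arcLength_add_arcLength_add_one x y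
  have hflip := arcLength_eq_ite x (y + 1) x
  have hlt := arcLength_lt x (y + 1)
  rw [arcLength_self] at hflip
  split_ifs at hflip <;> lia

theorem mem_of_next_block_ne {A : Set (ZMod N)} {x : ZMod N} (h : next (block A) x ≠ x) :
    x ∈ A ∧ next (block A) x ∈ A :=
  (rel_next (block A) x).resolve_left h.symm

theorem arcLength_next_block_le_one {A : Set (ZMod N)} {x y : ZMod N} (hx : x ∈ A)
    (hy : next (block A) y = x + 1) : arcLength y (next (block A) y) ≤ 1 := by
  have hadd := arcLength_add_one_right y x
  obtain hself | hself := eq_or_ne (next (block A) y) y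
  · rw [hself, arcLength_self]
    exact zero_le_one
  obtain rfl | hyx := eq_or_ne y x
  · rw [arcLength_self] at hadd
    rw [hy]
    lia
  · have hle := arcLength_next_le_arcLength
      (block_iff.2 (.inr ⟨(mem_of_next_block_ne hself).1, hx⟩))
      hyx
    rw [hy] at hle ⊢
    lia

/-- The quotient of `rot⁻¹` by the increasing cycle through `A`. -/
noncomputable def slow (A : Set (ZMod N)) : Equiv.Perm (ZMod N) :=
  rot⁻¹ * (nextPerm (block A))⁻¹

theorem inv_rot_mul_slow (A : Set (ZMod N)) : (rot * slow A)⁻¹ = nextPerm (block A) := by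
  simp [slow]

theorem slow_mul_rot_pow_inv_apply (A : Set (ZMod N)) (t : ℕ) (y : ZMod N) :
    (slow A * (rot ^ t)⁻¹ : Equiv.Perm (ZMod N)) (next (block A) y + t) = y - 1 := by
  rw [← Equiv.Perm.eq_inv_iff_eq]
  simp [slow, rot]

theorem slow_apply_next (A : Set (ZMod N)) (y : ZMod N) : slow A (next (block A) y) = y - 1 := by
  simpa using slow_mul_rot_pow_inv_apply A 0 y

theorem winding_slow_add (A : Set (ZMod N)) :
    winding (slow A) + winding (nextPerm (block A)) + 1 = N := by
  rw [← inv_rot_mul_slow, winding_add_winding_inv]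

theorem eq_slow_of_le_winding {w : Equiv.Perm (ZMod N)} (hw : N ≤ winding w + 2) :
    w = slow {x | (rot * w : Equiv.Perm (ZMod N))⁻¹ x ≠ x} := by
  have hsum := winding_add_winding_inv w
  rw [slow, ← eq_nextPerm_block_of_winding_le_one (v := (rot * w)⁻¹) (by lia)]
  simp

theorem exists_eq_next_block_add (A : Set (ZMod N)) (m x : ZMod N) :
    ∃ y, x = next (block A) y + m := by
  obtain ⟨y, hy⟩ := (nextPerm (block A)).surjective (x - m)
  exact ⟨y, eq_add_of_sub_eq hy.symm⟩

theorem arcLength_next_block_add {A : Set (ZMod N)} {t : ℕ} {y : ZMod N}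
    (h : arcLength y (next (block A) y) + t < N) :
    arcLength (next (block A) y + (t : ZMod N)) (y - 1) + arcLength y (next (block A) y) + t + 1 =
      N := by
  have hsum := arcLength_add_arcLength_add_one (next (block A) y + (t : ZMod N)) (y - 1)
  rw [sub_add_cancel, arcLength_add_natCast_right h] at hsum
  lia

theorem nextPerm_eq_rot {r : Setoid (ZMod N)} (h : ∀ x y, r x y) : nextPerm r = rot :=
  Equiv.ext fun x => next_eq (h _ _) fun z _ => by simp

theorem winding_rot (hN : 1 < N) : winding (rot : Equiv.Perm (ZMod N)) = 1 := by
  have hone (x : ZMod N) : arcLength x (rot x) = 1 := by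
    simpa using arcLength_add_natCast x hN
  apply Nat.eq_of_mul_eq_mul_left (NeZero.pos N)
  simp only [mul_winding, displacement, hone, sum_const_card]

theorem not_cut_add_one {i j : ZMod N} (hij : i ≠ j) : ¬ cut i j i (i + 1) := by
  have hj := (arcLength_right_inj (i + 1)).not.2 hij
  have hlt := arcLength_lt (i + 1) j
  rw [cut_iff, arcLength_self, arcLength_add_one_self]
  rw [arcLength_add_one_self] at hj
  lia

theorem two_le_winding_nextPerm_of_le_cut {r : Setoid (ZMod N)} {i j : ZMod N} (hij : i ≠ j)
    (hr : r ≤ cut i j) (hi : next r i ≠ i) (hi' : next r (i + 1) ≠ i + 1) :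
    2 ≤ winding (nextPerm r) := by
  have hnot (h : r i (i + 1)) : False := not_cut_add_one hij (hr h)
  have hone := arcLength_add_one_right i i
  have hne := arcLength_eq_zero.not.2 hi.symm
  have hne' := (arcLength_right_inj i).not.2 fun h : next r i = i + 1 => hnot (h ▸ rel_next r i)
  refine (two_le_winding_iff (i + 1)).2
    ⟨i, i + 1, fun h => hnot ((congrArg (r i) h).mp (r.refl' i)), ?_, ?_⟩
  · rw [arcLength_self] at hone
    rw [nextPerm_apply]
    lia
  · rw [arcLength_self, Nat.pos_iff_ne_zero]
    exact arcLength_eq_zero.not.2 hi'.symm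

theorem next_block_pair {a b : ZMod N} (hab : a ≠ b) : next (block {a, b}) a = b := by
  refine next_eq (block_iff.2 (.inr ⟨by simp, by simp⟩)) fun z hz => ?_
  obtain rfl | rfl : a = z ∨ z = b := by
    rw [block_iff] at hz
    grind
  · have := arcLength_lt (a + 1) b
    rw [arcLength_add_one_self]
    lia
  · rfl

end Slow

section SlowSymmetric

variable {n : ℕ}

/-- Invariance of a set of points of an even cycle under the half turn. -/
def IsCentrallySymmetric (A : Set (ZMod (2 * n))) : Prop :=
  ∀ x, x + (n : ZMod (2 * n)) ∈ A ↔ x ∈ A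

theorem natCast_ne_zero_of_lt {k : ℕ} (hk0 : k ≠ 0) (hk : k < 2 * n) :
    (k : ZMod (2 * n)) ≠ 0 := by
  rw [ne_eq, ZMod.natCast_eq_zero_iff]
  exact fun h => hk0 (Nat.eq_zero_of_dvd_of_lt h hk)

variable [NeZero n] {A : Set (ZMod (2 * n))}

theorem commute_slow (hA : IsCentrallySymmetric A) :
    Commute (slow A) (Equiv.addRight (n : ZMod (2 * n))) :=
  (commute_rot_addRight _).inv_left.mul_left
    (isTranslationInvariant_block hA).commute_nextPerm.inv_left

/-- The obstruction to a class without antipodal points: its short arc starts at a point `a` that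
`slow A * (rot ^ t)⁻¹` moves by less than `n`, which needs a long gap of `A`; so the gap preceding
`a + 1` is short and `a + 1` leaves the arc. -/
theorem ncOrbits_slow_mul_rel_antipode (hA : IsCentrallySymmetric A)
    (hgap : ∀ x, arcLength x (next (block A) x) < n) {t : ℕ} (ht : t + 2 ≤ n)
    (x : ZMod (2 * n)) : ncOrbits (slow A * (rot ^ t)⁻¹) x (x + n) := by
  set w := slow A * (rot ^ t)⁻¹
  have hcomm : Commute w (Equiv.addRight (n : ZMod (2 * n))) :=
    (commute_slow hA).mul_left ((commute_rot_addRight _).pow_left t).inv_left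
  have happ (y : ZMod (2 * n)) : w (next (block A) y + t) = y - 1 :=
    slow_mul_rot_pow_inv_apply A t y
  have hr := isNoncrossing_ncOrbits w
  by_contra hx
  obtain ⟨b, -, hlt⟩ := hr.exists_short_arc (isTranslationInvariant_ncOrbits hcomm) hx
  set a := next (ncOrbits w) b
  have hstay (p : ZMod (2 * n)) (hp : arcLength a p ≤ arcLength a b) :
      arcLength a (w p) ≤ arcLength a b := hr.arcLength_le_of_rel (rel_ncOrbits w p) hp
  obtain ⟨y, hy⟩ := exists_eq_next_block_add A t a
  obtain ⟨y', hy'⟩ := exists_eq_next_block_add A t (a + 1)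
  have hgapy := hgap y
  have hstep := arcLength_next_block_add (A := A) (t := t) (y := y) (by lia)
  have hstay_a := hstay a (by simp)
  rw [show w a = y - 1 from hy ▸ happ y] at hstay_a
  rw [← hy] at hstep
  have hyA : next (block A) y ∈ A := (mem_of_next_block_ne fun h => by
    rw [h, arcLength_self] at hstep
    lia).2
  have hgapy' : arcLength y' (next (block A) y') ≤ 1 :=
    arcLength_next_block_le_one hyA (by linear_combination hy - hy')
  have hstep' := arcLength_next_block_add (A := A) (t := t) (y := y') (by lia)
  have hone := arcLength_add_one_right a a
  rw [arcLength_self] at hone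
  have hstay_a' := hstay (a + 1) (by lia)
  rw [show w (a + 1) = y' - 1 from hy' ▸ happ y'] at hstay_a'
  rw [← hy', arcLength_add_one_left a, arcLength_self] at hstep'
  split_ifs at hstep' <;> lia

theorem nextPerm_ncOrbits_slow_mul (hA : IsCentrallySymmetric A)
    (hgap : ∀ x, arcLength x (next (block A) x) < n) {t : ℕ} (ht : t + 2 ≤ n) :
    nextPerm (ncOrbits (slow A * (rot ^ t)⁻¹)) = rot :=
  nextPerm_eq_rot fun x y => (isNoncrossing_ncOrbits _).rel_of_rel_antipode
    (ncOrbits_slow_mul_rel_antipode hA hgap ht x) (ncOrbits_slow_mul_rel_antipode hA hgap ht y)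

theorem popCycle_iterate_slow (hA : IsCentrallySymmetric A)
    (hgap : ∀ x, arcLength x (next (block A) x) < n) {t : ℕ} (ht : t + 1 ≤ n) :
    popCycle^[t] (slow A) = slow A * (rot ^ t)⁻¹ := by
  induction t with
  | zero => simp
  | succ t ih =>
    rw [Function.iterate_succ_apply', ih (by lia), popCycle,
      nextPerm_ncOrbits_slow_mul hA hgap ht, pow_succ', mul_inv_rev, mul_assoc]

theorem winding_popCycle_iterate_slow_add (hA : IsCentrallySymmetric A)
    (hgap : ∀ x, arcLength x (next (block A) x) < n) {t : ℕ} (ht : t + 1 ≤ n) :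
    winding (popCycle^[t] (slow A)) + t = winding (slow A) := by
  induction t with
  | zero => rfl
  | succ t ih =>
    have hdrop := winding_nextPerm_add_winding_popCycle (popCycle^[t] (slow A))
    rw [popCycle_iterate_slow hA hgap (by lia), nextPerm_ncOrbits_slow_mul hA hgap ht,
      winding_rot (by lia), ← popCycle_iterate_slow hA hgap (by lia),
      ← Function.iterate_succ_apply' popCycle] at hdrop
    have hprev := ih (by lia)
    lia

theorem popCycle_iterate_slow_ne_one (hn : 2 ≤ n) (hA : IsCentrallySymmetric A)
    (hgap : ∀ x, arcLength x (next (block A) x) < n) : popCycle^[2 * n - 3] (slow A) ≠ 1 := by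
  have hd (x : ZMod (2 * n)) : arcLength x ((popCycle^[n - 1] (slow A)) x) ≤ n := by
    obtain ⟨y, rfl⟩ := exists_eq_next_block_add A (n - 1 : ℕ) x
    rw [popCycle_iterate_slow hA hgap (by lia), slow_mul_rot_pow_inv_apply]
    have hgapy := hgap y
    have hstep := arcLength_next_block_add (A := A) (t := n - 1) (y := y) (by lia)
    lia
  have hfirst := winding_popCycle_iterate_slow_add hA hgap (t := n - 1) (by lia)
  have hlast := winding_le_winding_popCycle_iterate_add
    (commute_popCycle_iterate (commute_slow hA) (n - 1)) hd (n - 2)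
  rw [← Function.iterate_add_apply, show n - 2 + (n - 1) = 2 * n - 3 by lia] at hlast
  have hsum := winding_slow_add A
  have hblock := winding_nextPerm_block_le_one A
  intro hone
  rw [hone, winding_eq_zero_iff.2 rfl] at hlast
  lia

theorem eq_pair_of_le_arcLength_next_block (hA : IsCentrallySymmetric A) {x : ZMod (2 * n)}
    (hx : n ≤ arcLength x (next (block A) x)) : A = {x, x + (n : ZMod (2 * n))} := by
  have hpos := NeZero.pos n
  have hxA : x ∈ A := by
    by_contra h
    rw [next_block_eq_self h, arcLength_self] at hx
    lia
  have hfar {z : ZMod (2 * n)} (hz : z ∈ A) (hzx : z ≠ x) : n ≤ arcLength x z :=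
    hx.trans (arcLength_next_le_arcLength (block_iff.2 (.inr ⟨hxA, hz⟩)) hzx.symm)
  refine Set.Subset.antisymm (fun z hz => or_iff_not_imp_left.2 fun hzx => ?_)
    (Set.insert_subset hxA (Set.singleton_subset_iff.2 ((hA x).2 hxA)))
  have hzn : z + n = x := by
    by_contra hne
    have hz₁ := hfar hz hzx
    have hz₂ := hfar ((hA z).2 hz) hne
    have hanti := arcLength_antipode z
    have hlt₁ := arcLength_lt x z
    have hlt₂ := arcLength_lt x (z + n)
    rw [arcLength_eq_ite x] at hanti
    split_ifs at hanti <;> lia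
  rw [Set.mem_singleton_iff, ← hzn, add_assoc, half_add_half, add_zero]

theorem next_block_antipodal_pair {a x : ZMod (2 * n)}
    (hx : x ∈ ({a, a + (n : ZMod (2 * n))} : Set (ZMod (2 * n)))) :
    next (block {a, a + (n : ZMod (2 * n))}) x = x + n := by
  have hpos := NeZero.pos n
  have hne : a ≠ a + (n : ZMod (2 * n)) := by
    simpa using natCast_ne_zero_of_lt hpos.ne' (by lia)
  obtain rfl | rfl := hx
  · exact next_block_pair hne
  · rw [Set.pair_comm, add_assoc _ (n : ZMod (2 * n)), half_add_half, add_zero]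
    exact next_block_pair hne.symm

theorem slow_antipodal_pair_apply_ne (hn : 2 ≤ n) (a x : ZMod (2 * n)) :
    slow {a, a + (n : ZMod (2 * n))} x ≠ x := by
  obtain ⟨y, rfl⟩ := (nextPerm (block {a, a + (n : ZMod (2 * n))})).surjective x
  rw [nextPerm_apply, slow_apply_next]
  intro h
  by_cases hy : y ∈ ({a, a + (n : ZMod (2 * n))} : Set (ZMod (2 * n)))
  · rw [next_block_antipodal_pair hy] at h
    refine natCast_ne_zero_of_lt (n := n) (k := n + 1) (by lia) (by lia) ?_
    push_cast
    linear_combination -h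
  · rw [next_block_eq_self hy] at h
    refine natCast_ne_zero_of_lt (n := n) (k := 1) (by lia) (by lia) ?_
    push_cast
    linear_combination -h

theorem ncOrbits_slow_antipodal_pair_le (i : ZMod (2 * n)) :
    ncOrbits (slow {i + 1, i + 1 + (n : ZMod (2 * n))}) ≤ cut i (i + n) := by
  refine ncOrbits_le (isNoncrossing_cut _ _) fun x => ?_
  obtain ⟨y, rfl⟩ := (nextPerm (block {i + 1, i + 1 + (n : ZMod (2 * n))})).surjective x
  have hpos := NeZero.pos n
  have hself := arcLength_self (i + 1)
  have hanti := arcLength_antipode (i + 1)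
  have hpred (y : ZMod (2 * n)) := arcLength_add_one_right (i + 1) (y - 1)
  simp only [sub_add_cancel] at hpred
  have hlast := arcLength_add_one_self i
  have hcut : arcLength (i + 1) (i + (n : ZMod (2 * n))) = n - 1 := by
    have := hpred (i + 1 + (n : ZMod (2 * n)))
    rw [add_sub_right_comm, add_sub_cancel_right] at this
    lia
  rw [nextPerm_apply, slow_apply_next, cut_iff, hcut]
  by_cases hy : y ∈ ({i + 1, i + 1 + (n : ZMod (2 * n))} : Set (ZMod (2 * n)))
  · rw [next_block_antipodal_pair hy]
    obtain rfl | rfl := hy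
    · rw [add_sub_cancel_right]
      lia
    · rw [add_assoc _ (n : ZMod (2 * n)), half_add_half, add_zero, add_sub_right_comm,
        add_sub_cancel_right]
      lia
  · rw [next_block_eq_self hy]
    have hy₀ := (arcLength_right_inj (i + 1)).not.2 fun h => hy (.inl h)
    have hyn := (arcLength_right_inj (i + 1)).not.2 fun h => hy (.inr h)
    have := hpred y
    lia

theorem popCycle_iterate_slow_antipodal_pair (hn : 2 ≤ n) (a : ZMod (2 * n)) :
    popCycle^[2 * n - 3] (slow {a, a + (n : ZMod (2 * n))}) = 1 := by
  obtain ⟨i, rfl⟩ := add_right_surjective (1 : ZMod (2 * n)) a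
  set A : Set (ZMod (2 * n)) := {i + 1, i + 1 + (n : ZMod (2 * n))}
  have hn₀ : (n : ZMod (2 * n)) ≠ 0 := natCast_ne_zero_of_lt (by lia) (by lia)
  have hmoved (x : ZMod (2 * n)) : next (ncOrbits (slow A)) x ≠ x :=
    next_ncOrbits_eq_self_iff.not.2 (slow_antipodal_pair_apply_ne hn _ x)
  have htwo : 2 ≤ winding (nextPerm (ncOrbits (slow A))) :=
    two_le_winding_nextPerm_of_le_cut (by simpa using hn₀) (ncOrbits_slow_antipodal_pair_le i)
      (hmoved _) (hmoved _)
  have hblock : winding (nextPerm (block A)) ≠ 0 := by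
    rw [ne_eq, winding_eq_zero_iff]
    intro h
    have hnext := next_block_antipodal_pair (a := i + 1) (x := i + 1) (.inl rfl)
    rw [← nextPerm_apply, h] at hnext
    exact hn₀ (by simpa using hnext)
  have hsum := winding_slow_add A
  have hfirst := winding_nextPerm_add_winding_popCycle (slow A)
  have hrest := winding_popCycle_iterate_le (popCycle (slow A)) (2 * n - 4)
  rw [← Function.iterate_succ_apply, show (2 * n - 4).succ = 2 * n - 3 by lia] at hrest
  exact winding_eq_zero_iff.1 (by lia)

theorem popCycle_iterate_ne_one_iff (hn : 2 ≤ n) {w : Equiv.Perm (ZMod (2 * n))}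
    (hw : Commute w (Equiv.addRight (n : ZMod (2 * n)))) :
    popCycle^[2 * n - 3] w ≠ 1 ↔
      ∃ A, IsCentrallySymmetric A ∧ (∀ a, A ≠ {a, a + (n : ZMod (2 * n))}) ∧ slow A = w := by
  refine ⟨fun h => ?_, ?_⟩
  · have hiter := winding_popCycle_iterate_le w (2 * n - 3)
    have hpos := winding_eq_zero_iff.not.2 h
    have hslow := eq_slow_of_le_winding (w := w) (by lia)
    refine ⟨_, fun x => not_congr ?_, fun a ha => h ?_, hslow.symm⟩
    · have hcomm := commute_addRight_iff.1 ((commute_rot_addRight _).mul_left hw).inv_left x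
      rw [hcomm, add_left_inj]
    · rw [hslow, ha, popCycle_iterate_slow_antipodal_pair hn]
  · rintro ⟨A, hA, hpair, rfl⟩
    refine popCycle_iterate_slow_ne_one hn hA fun x => ?_
    by_contra! hx
    exact hpair x (eq_pair_of_le_arcLength_next_block hA hx)

end SlowSymmetric

section Iterations

variable {N : ℕ} [NeZero N]

theorem isLeast_popCycle_iterate_eq_one_iff (hN : 3 ≤ N) {w : Equiv.Perm (ZMod N)} :
    (IsLeast {m | popCycle^[m] w = 1} (N - 2) ∨ IsLeast {m | popCycle^[m] w = 1} (N - 1)) ↔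
      popCycle^[N - 3] w ≠ 1 := by
  have hstay {k m : ℕ} (hkm : k ≤ m) (hk : popCycle^[k] w = 1) : popCycle^[m] w = 1 := by
    rw [← Nat.sub_add_cancel hkm, Function.iterate_add_apply, hk]
    exact Function.iterate_fixed popCycle_one _
  have hone : popCycle^[N - 1] w = 1 := by
    have hsum := winding_add_winding_inv w
    have hiter := winding_popCycle_iterate_le w (N - 1)
    exact winding_eq_zero_iff.1 (by lia)
  constructor
  · rintro (h | h) h'
    · have := h.2 h'
      lia
    · have := h.2 h'
      lia
  · intro h
    have hlow {m : ℕ} (hm : popCycle^[m] w = 1) : N - 2 ≤ m := by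
      by_contra! hlt
      exact h (hstay (by lia) hm)
    by_cases h2 : popCycle^[N - 2] w = 1
    · exact .inl ⟨h2, fun m hm => hlow hm⟩
    · refine .inr ⟨hone, fun m hm => ?_⟩
      by_contra! hlt
      exact h2 (hstay (by lia) hm)

end Iterations

/-! ### Coxeter elements act as rotations of an even cycle -/

section Coxeter

open Finset

/-- Summing `f ∘ s = f ∘ u⁻¹` over `P` gives `∑ f ∘ s = ∑ f`, where only the terms at `p` can
differ. -/
theorem apply_eq_of_comp_invariant {α M : Type*} [Finite α] [AddCommGroup M]
    {s u : Equiv.Perm α} {P : α → Prop} {p : α} {f : α → M} (hu : ∀ x, P (u x) ↔ P x)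
    (hs : ∀ x, P x → x ≠ p → s x = x) (hp : P p) (hf : ∀ x, f (s (u x)) = f x) :
    f (s p) = f p := by
  classical
  cases nonempty_fintype α
  have hsum : ∑ y, (if P y then f (s y) else 0) = ∑ y, if P y then f y else 0 := by
    rw [← Equiv.sum_comp u fun y => if P y then f (s y) else 0]
    simp only [hu, hf]
  rw [← sub_eq_zero, ← sum_sub_distrib, sum_eq_single p, if_pos hp, if_pos hp, sub_eq_zero] at hsum
  · exact hsum
  · intro y _ hy
    split_ifs with h
    · rw [hs y h hy, sub_self]
    · exact sub_self 0
  · simp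

variable {n : ℕ} {i j : Fin n} {x : SignedPoint n}

theorem apply_signedSwap_eq {β : Type*} {f : SignedPoint n → β} {a b : SignedPoint n}
    (h : f a = f b) (h' : f (bar a) = f (bar b)) (x : SignedPoint n) :
    f ((signedSwap a b).1 x) = f x := by
  rw [signedSwap_apply]
  split_ifs with h₁ h₂ h₃ h₄
  · rw [h₁, h]
  · rw [h₂, h]
  · rw [h₃, h']
  · rw [h₄, h']
  · rfl

/-- The lower end of the edge of the path `-n, …, -1, 1, …, n` with upper end `(i, false)`, which
`simpleReflection i` flips together with the opposite edge. -/
def lowerEnd (i : Fin n) : SignedPoint n :=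
  if (i : ℕ) = 0 then (i, true)
  else (⟨(i : ℕ) - 1, lt_of_le_of_lt (Nat.sub_le _ _) i.isLt⟩, false)

theorem simpleReflection_eq_signedSwap_lowerEnd (i : Fin n) :
    simpleReflection i = signedSwap (i, false) (lowerEnd i) := by
  unfold simpleReflection lowerEnd
  split_ifs
  · exact signChange_eq_signedSwap i
  · rw [liftPerm_swap_eq_signedSwap, signedSwap_comm]

theorem simpleReflection_apply_upperEnd (i : Fin n) :
    (simpleReflection i).1 (i, false) = lowerEnd i := by
  rw [simpleReflection_eq_signedSwap_lowerEnd, signedSwap_apply_left]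

/-- The points on the upper side of the edge of the path `-n, …, -1, 1, …, n` that
`simpleReflection i` flips. -/
def IsAbove (i : Fin n) (x : SignedPoint n) : Prop := x.2 = false ∧ i ≤ x.1

theorem isAbove_simpleReflection (hij : i ≠ j) (x : SignedPoint n) :
    IsAbove i ((simpleReflection j).1 x) ↔ IsAbove i x := by
  have hij' : (i : ℕ) ≠ j := fun h => hij (Fin.ext h)
  rw [simpleReflection_eq_signedSwap_lowerEnd]
  refine iff_of_eq (apply_signedSwap_eq (f := IsAbove i) ?_ ?_ x) <;>
    unfold lowerEnd <;> split_ifs <;> simp only [IsAbove, bar, Fin.le_def, Bool.not_false,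
      Bool.not_true, true_and, false_and, reduceCtorEq, eq_iff_iff] <;> lia

theorem isAbove_prod_simpleReflection {l : List (Fin n)} (hi : i ∉ l) (x : SignedPoint n) :
    IsAbove i ((l.map simpleReflection).prod.1 x) ↔ IsAbove i x := by
  induction l with
  | nil => rfl
  | cons j l ih =>
    rw [List.mem_cons, not_or] at hi
    rw [List.map_cons, List.prod_cons, Hyperoctahedral.mul_apply, isAbove_simpleReflection hi.1,
      ih hi.2]

theorem simpleReflection_apply_of_isAbove (hx : IsAbove i x) (hne : x ≠ (i, false)) :
    (simpleReflection i).1 x = x := by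
  obtain ⟨k, b⟩ := x
  obtain ⟨rfl, hik⟩ : b = false ∧ i ≤ k := hx
  rw [Fin.le_def] at hik
  have hki : (k : ℕ) ≠ i := fun h => hne (by rw [Fin.ext h])
  rw [simpleReflection_eq_signedSwap_lowerEnd]
  unfold lowerEnd
  apply signedSwap_apply_of_ne hne <;> try split_ifs
  all_goals simp only [bar, ne_eq, Prod.mk.injEq, Fin.ext_iff, Bool.not_false, Bool.not_true,
    reduceCtorEq, and_false, not_false_eq_true, and_true] <;> lia

variable {M : Type*} [AddCommGroup M] {f : SignedPoint n → M}

theorem apply_simpleReflection_of_prod_invariant {l : List (Fin n)} (hl : l.Nodup)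
    (hf : ∀ x, f ((l.map simpleReflection).prod.1 x) = f x) :
    ∀ i ∈ l, ∀ x, f ((simpleReflection i).1 x) = f x := by
  induction l with
  | nil => simp
  | cons i l ih =>
    obtain ⟨hil, hl⟩ := List.nodup_cons.1 hl
    simp only [List.map_cons, List.prod_cons, Hyperoctahedral.mul_apply] at hf
    have apply_upperEnd : ∀ g : SignedPoint n → M,
        (∀ x, g ((simpleReflection i).1 ((l.map simpleReflection).prod.1 x)) = g x) →
          g (lowerEnd i) = g (i, false) := fun g hg =>
      simpleReflection_apply_upperEnd i ▸ apply_eq_of_comp_invariant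
        (isAbove_prod_simpleReflection hil) (fun _ => simpleReflection_apply_of_isAbove)
        ⟨rfl, le_rfl⟩ hg
    have invariant_head : ∀ x, f ((simpleReflection i).1 x) = f x := by
      rw [simpleReflection_eq_signedSwap_lowerEnd]
      exact apply_signedSwap_eq (apply_upperEnd f hf).symm (apply_upperEnd (f ∘ bar) fun x => by
        simp only [Function.comp_apply, ← Hyperoctahedral.apply_bar, hf]).symm
    exact List.forall_mem_cons.2 ⟨invariant_head, ih hl fun x => by rw [← hf x, invariant_head]⟩

theorem eq_of_simpleReflection_invariant {β : Type*} {f : SignedPoint n → β}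
    (hf : ∀ i x, f ((simpleReflection i).1 x) = f x) (x y : SignedPoint n) : f x = f y := by
  let o : Fin n := ⟨0, x.1.pos⟩
  have apply_lowerEnd : ∀ i, f (lowerEnd i) = f (i, false) ∧
      f (bar (lowerEnd i)) = f (bar (i, false)) := fun i => by
    rw [← simpleReflection_apply_upperEnd, ← Hyperoctahedral.apply_bar]
    exact ⟨hf i _, hf i _⟩
  have eq_base : ∀ k (hk : k < n), f (⟨k, hk⟩, false) = f (o, false) ∧
      f (⟨k, hk⟩, true) = f (o, false) := by
    intro k
    induction k with
    | zero => exact fun _ => ⟨rfl, (apply_lowerEnd o).1⟩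
    | succ k ih =>
      intro hk
      have hlower : lowerEnd (⟨k + 1, hk⟩ : Fin n) = (⟨k, k.lt_succ_self.trans hk⟩, false) := by
        simp [lowerEnd]
      have h := apply_lowerEnd ⟨k + 1, hk⟩
      rw [hlower] at h
      exact ⟨h.1.symm.trans (ih _).1, h.2.symm.trans (ih _).2⟩
  have eq_base' : ∀ z, f z = f (o, false)
    | (i, false) => (eq_base i i.isLt).1
    | (i, true) => (eq_base i i.isLt).2
  rw [eq_base' x, eq_base' y]

theorem IsCoxeterElement.sameCycle {c : Hyperoctahedral n} (hc : IsCoxeterElement c)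
    (x y : SignedPoint n) : c.1.SameCycle x y := by
  classical
  obtain ⟨σ, hσ⟩ := hc
  have hprod : c = ((List.ofFn σ).map simpleReflection).prod := by
    rw [hσ, List.map_ofFn]
    rfl
  let f : SignedPoint n → ℤ := fun z => if c.1.SameCycle x z then 1 else 0
  have hfc : ∀ z, f (c.1 z) = f z := fun z => by
    simp only [f, Equiv.Perm.sameCycle_apply_right]
  have hf := apply_simpleReflection_of_prod_invariant (List.nodup_ofFn.2 σ.injective)
    (hprod ▸ hfc)
  have hxy : f x = f y := eq_of_simpleReflection_invariant
    (fun i => hf i (List.mem_ofFn.2 ⟨σ.symm i, σ.apply_symm_apply i⟩)) x y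
  by_contra hcon
  simp [f, hcon, Equiv.Perm.SameCycle.refl] at hxy

end Coxeter

section Rotation

variable {α : Type*} {m n : ℕ}

theorem exists_equiv_zmod_of_sameCycle [Nonempty α] {σ : Equiv.Perm α}
    (hσ : ∀ x y, σ.SameCycle x y) : ∃ e : α ≃ ZMod (Nat.card α), ∀ x, e (σ x) = e x + 1 := by
  obtain ⟨o⟩ := ‹Nonempty α›
  have horbit : MulAction.orbit (Subgroup.zpowers σ) o = Set.univ :=
    Set.eq_univ_of_forall fun x => let ⟨k, hk⟩ := hσ o x; ⟨⟨σ ^ k, k, rfl⟩, hk⟩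
  let e : α ≃ ZMod (Function.minimalPeriod (σ • ·) o) :=
    ((Equiv.Set.univ α).symm.trans (Equiv.setCongr horbit.symm)).trans
      (MulAction.orbitZPowersEquiv σ o)
  have e_symm : ∀ k : ℤ, e.symm k = (σ ^ k) o := fun k =>
    congrArg Subtype.val (MulAction.orbitZPowersEquiv_symm_apply' σ o k)
  have hcard : Nat.card α = Function.minimalPeriod (σ • ·) o := by
    rw [Nat.card_congr e, Nat.card_zmod]
  rw [hcard]
  refine ⟨e, fun x => ?_⟩
  obtain ⟨k, hk⟩ := ZMod.intCast_surjective (e x)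
  rw [← Equiv.eq_symm_apply, ← hk, ← Int.cast_one, ← Int.cast_add, e_symm, add_comm,
    zpow_add, zpow_one, Equiv.Perm.mul_apply, ← e_symm, hk, e.symm_apply_apply]

theorem eq_add_apply_zero {g : ZMod m → ZMod m} (hg : ∀ x, g (x + 1) = g x + 1) (x : ZMod m) :
    g x = x + g 0 := by
  obtain ⟨k, rfl⟩ := ZMod.intCast_surjective x
  have h := AddConstMapClass.map_add_int (⟨g, hg⟩ : AddConstMap (ZMod m) (ZMod m) 1 1) 0 k
  rw [zero_add] at h
  exact h.trans (add_comm _ _)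

theorem eq_natCast_of_add_self_eq_zero [NeZero n] {a : ZMod (2 * n)} (h : a + a = 0)
    (h0 : a ≠ 0) : a = n := by
  have hval : 2 * a.val = 2 * n :=
    ((ZMod.neg_eq_self_iff a).1 (neg_eq_of_add_eq_zero_left h)).resolve_left h0
  rw [← ZMod.natCast_zmod_val a, Nat.eq_of_mul_eq_mul_left two_pos hval]

/-- A labelling of an even cycle by `±[n]` that turns negation into the half turn. -/
def IsAntipodal (e : SignedPoint n ≃ ZMod (2 * n)) : Prop :=
  ∀ x, e (bar x) = e x + (n : ZMod (2 * n))

theorem exists_equiv_zmod_two_mul [NeZero n] {c : Hyperoctahedral n}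
    (hc : ∀ x y, c.1.SameCycle x y) :
    ∃ e : SignedPoint n ≃ ZMod (2 * n), (∀ x, e (c.1 x) = e x + 1) ∧ IsAntipodal e := by
  have hcard : Nat.card (SignedPoint n) = 2 * n := by
    rw [Nat.card_prod, Nat.card_fin, Nat.card_eq_fintype_card, Fintype.card_bool, mul_comm]
  obtain ⟨e, he⟩ := exists_equiv_zmod_of_sameCycle hc
  revert e
  rw [hcard]
  intro e he
  refine ⟨e, he, ?_⟩
  let g : ZMod (2 * n) → ZMod (2 * n) := fun x => e (bar (e.symm x))
  have e_symm_add_one : ∀ x, e.symm (x + 1) = c.1 (e.symm x) := fun x => by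
    rw [Equiv.symm_apply_eq, he, e.apply_symm_apply]
  have hg : ∀ x, g x = x + g 0 := eq_add_apply_zero fun x => by
    simp only [g, e_symm_add_one, ← Hyperoctahedral.apply_bar, he]
  have hgg : g 0 + g 0 = 0 := by
    rw [← hg]
    simp [g]
  have hg0 : g 0 ≠ 0 := fun h => bar_ne (e.symm 0) ((Equiv.eq_symm_apply e).2 h)
  intro x
  rw [← eq_natCast_of_add_self_eq_zero hgg hg0, ← hg]
  simp only [g, e.symm_apply_apply]

end Rotation

/-! ### The noncrossing projection on the cycle -/

section Cut

theorem cut_add_right {N : ℕ} {i j m x y : ZMod N} :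
    cut (i + m) (j + m) (x + m) (y + m) ↔ cut i j x y := by
  simp only [cut_iff, add_right_comm i m 1, arcLength_add_right]

theorem arcLength_lt_of_next_eq_next {N : ℕ} [NeZero N] {r s : Setoid (ZMod N)} {i j : ZMod N}
    (hrs : r ≤ s) (hj : next s j = next r i) (hij : i ≠ j) :
    arcLength (i + 1) j < arcLength (i + 1) (next r i) := by
  have hsji : s j i := s.trans' (rel_next s j) (hj ▸ s.symm' (hrs (rel_next r i)))
  have hle := arcLength_next_le hsji
  have hpos := (arcLength_right_inj (i + 1)).not.2 hij
  have hi := arcLength_add_one_self i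
  have hjN := arcLength_lt (i + 1) j
  simp only [hj, arcLength_add_one_left (i + 1) j] at hle
  split_ifs at hle <;> lia

theorem IsNoncrossing.le_cut {N : ℕ} [NeZero N] {r s : Setoid (ZMod N)} (hr : IsNoncrossing r)
    (hs : IsNoncrossing s) (hrs : r ≤ s) {i j : ZMod N} (hj : next s j = next r i) (hij : i ≠ j) :
    r ≤ cut i j := by
  suffices stays : ∀ x y, r x y → arcLength (i + 1) x ≤ arcLength (i + 1) j →
      arcLength (i + 1) y ≤ arcLength (i + 1) j from
    fun x y hxy => cut_iff.2 ⟨stays x y hxy, stays y x (r.symm' hxy)⟩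
  intro x y hxy hx
  by_contra! hy
  have hjb := arcLength_lt_of_next_eq_next hrs hj hij
  have hsji : s j i := s.trans' (rel_next s j) (hj ▸ s.symm' (hrs (rel_next r i)))
  have hix : ¬ r i x := fun h => by
    have := arcLength_next_le h
    lia
  have hne {z w : ZMod N} (h : z ≠ w) := (arcLength_right_inj (i + 1)).not.2 h
  have hyi := hne fun h : y = i => hix (r.symm' (h ▸ hxy))
  have hi := arcLength_add_one_self i
  have hyN := arcLength_lt (i + 1) y
  by_cases hsxj : s j x
  · have hby := arcLength_next_le (s.trans' hsxj (hrs hxy))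
    rw [hj, arcLength_add_one_left (i + 1) j, arcLength_add_one_left (i + 1) j, if_pos hjb,
      if_pos hy] at hby
    have hyb := hne fun h : y = next r i =>
      hix (r.trans' (rel_next r i) (r.symm' (h ▸ hxy)))
    have hxb := hr.rel_of_lt (i + 1) (a := x) (b := next r i) (c := y) (d := i) (by lia) (by lia)
      (by lia) hxy (r.symm' (rel_next r i))
    exact hix (r.trans' (rel_next r i) (r.symm' hxb))
  · have hxj := hne fun h : x = j => hsxj (h ▸ s.refl' j)
    exact hsxj (s.symm' (hs.rel_of_lt (i + 1) (a := x) (b := j) (c := y) (d := i) (by lia)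
      (by lia) (by lia) (hrs hxy) hsji))

variable {n : ℕ} {r : Setoid (ZMod (2 * n))} {a b : ZMod (2 * n)}

/-- The refinement of an equivalence relation along an arc and the opposite arc. -/
def symCut (r : Setoid (ZMod (2 * n))) (a b : ZMod (2 * n)) : Setoid (ZMod (2 * n)) :=
  r ⊓ cut a b ⊓ cut (a + (n : ZMod (2 * n))) (b + (n : ZMod (2 * n)))

theorem cut_antipodes {x y : ZMod (2 * n)} :
    cut (a + (n : ZMod (2 * n))) (b + (n : ZMod (2 * n))) x y ↔
      cut a b (x + (n : ZMod (2 * n))) (y + (n : ZMod (2 * n))) := by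
  rw [← cut_add_right (m := (n : ZMod (2 * n))) (i := a), add_assoc x, add_assoc y,
    half_add_half, add_zero, add_zero]

theorem isTranslationInvariant_symCut (hr : IsTranslationInvariant (n : ZMod (2 * n)) r)
    (a b : ZMod (2 * n)) :
    IsTranslationInvariant (n : ZMod (2 * n)) (symCut r a b) := fun x y => by
  have hleft : (r ⊓ cut a b) (x + (n : ZMod (2 * n))) (y + (n : ZMod (2 * n))) ↔
      r x y ∧ cut (a + (n : ZMod (2 * n))) (b + (n : ZMod (2 * n))) x y :=
    and_congr (hr x y) cut_antipodes.symm
  exact (and_congr hleft cut_add_right).trans and_right_comm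

theorem le_symCut {s : Setoid (ZMod (2 * n))} (hr : IsTranslationInvariant (n : ZMod (2 * n)) r)
    (hrs : r ≤ s) (hcut : r ≤ cut a b) : r ≤ symCut s a b :=
  le_inf (le_inf hrs hcut) fun x y hxy => cut_antipodes.2 (hcut ((hr x y).2 hxy))

variable [NeZero n]

theorem isNoncrossing_symCut (hr : IsNoncrossing r) (a b : ZMod (2 * n)) :
    IsNoncrossing (symCut r a b) :=
  (hr.inf (isNoncrossing_cut _ _)).inf (isNoncrossing_cut _ _)

theorem symCut_antipode (r : Setoid (ZMod (2 * n))) (a : ZMod (2 * n)) :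
    symCut r a (a + (n : ZMod (2 * n))) = r ⊓ cut a (a + (n : ZMod (2 * n))) := by
  refine inf_eq_left.2 fun x y hxy => ?_
  have hpos := NeZero.pos n
  have hside (z : ZMod (2 * n)) :
      arcLength (a + 1) z ≤ arcLength (a + 1) (a + (n : ZMod (2 * n))) ↔
        ¬ arcLength (a + (n : ZMod (2 * n)) + 1) z ≤
          arcLength (a + (n : ZMod (2 * n)) + 1) a := by
    have hz := arcLength_lt a z
    simp only [arcLength_add_one_left a, arcLength_antipode, arcLength_self]
    split_ifs <;> lia
  rw [add_assoc, half_add_half, add_zero, cut_iff, ← not_iff_not, ← hside, ← hside]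
  exact cut_iff.1 hxy.2

theorem cut_self_antipodes (hab : b ≠ a + (n : ZMod (2 * n))) :
    cut a b (a + (n : ZMod (2 * n))) (b + (n : ZMod (2 * n))) := by
  have hd := (arcLength_right_inj a).not.2 hab
  have hbn := arcLength_eq_ite a b (b + (n : ZMod (2 * n)))
  rw [arcLength_antipode] at hd hbn
  have := arcLength_lt a b
  have := arcLength_lt a (b + (n : ZMod (2 * n)))
  have := NeZero.pos n
  simp only [cut_iff, arcLength_add_one_left a a, arcLength_self, arcLength_antipode]
  split_ifs at * <;> lia

theorem IsNoncrossing.nextPerm_mul_swap_mul_swap (hr : IsNoncrossing r)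
    (hs : IsTranslationInvariant (n : ZMod (2 * n)) r) (hab : r a b) (hne : a ≠ b)
    (hne' : b ≠ a + (n : ZMod (2 * n))) :
    nextPerm r * (Equiv.swap a b *
      Equiv.swap (a + (n : ZMod (2 * n))) (b + (n : ZMod (2 * n)))) = nextPerm (symCut r a b) := by
  rw [← mul_assoc, hr.nextPerm_mul_swap hab hne,
    (hr.inf (isNoncrossing_cut _ _)).nextPerm_mul_swap ⟨(hs a b).2 hab, cut_self_antipodes hne'⟩
      ((add_left_injective _).ne hne)]
  rfl

end Cut

section Transport

variable {n N : ℕ} (e : SignedPoint n ≃ ZMod N)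

/-- The permutation of a cycle labelled by `±[n]` that corresponds to a signed permutation. -/
def toCycle : Hyperoctahedral n →* Equiv.Perm (ZMod N) :=
  e.permCongrHom.toMonoidHom.comp (Hyperoctahedral n).subtype

variable {e}

@[simp] theorem toCycle_apply_apply (w : Hyperoctahedral n) (x : SignedPoint n) :
    toCycle e w (e x) = e (w.1 x) :=
  congrArg (fun y => e (w.1 y)) (e.symm_apply_apply x)

theorem toCycle_injective : Function.Injective (toCycle e) :=
  e.permCongrHom.injective.comp Subtype.val_injective

theorem sameCycle_toCycle_iff {w : Hyperoctahedral n} {x y : SignedPoint n} :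
    (toCycle e w).SameCycle (e x) (e y) ↔ w.1.SameCycle x y := by
  refine exists_congr fun k => ?_
  rw [← map_zpow, toCycle_apply_apply, e.apply_eq_iff_eq]
  rfl

theorem toCycle_signedSwap_bar (i : SignedPoint n) :
    toCycle e (signedSwap i (bar i)) = Equiv.swap (e i) (e (bar i)) := by
  ext x : 1
  obtain ⟨x, rfl⟩ := e.surjective x
  rw [toCycle_apply_apply, signedSwap_apply, Equiv.swap_apply_def, bar_bar]
  simp only [e.apply_eq_iff_eq]
  split_ifs <;> rfl

theorem toCycle_signedSwap {i j : SignedPoint n} (h : j ≠ bar i) :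
    toCycle e (signedSwap i j) =
      Equiv.swap (e i) (e j) * Equiv.swap (e (bar i)) (e (bar j)) := by
  ext x : 1
  obtain ⟨x, rfl⟩ := e.surjective x
  have hi := bar_ne i
  have hj := bar_ne j
  have hij : bar i = j ↔ i = bar j := bar_eq_iff
  have hij' : bar i = bar j ↔ i = j := bar_inj
  rw [toCycle_apply_apply, signedSwap_apply, Equiv.Perm.mul_apply]
  simp only [Equiv.swap_apply_def, e.apply_eq_iff_eq]
  grind [EmbeddingLike.apply_eq_iff_eq]

end Transport

section Projection

variable {n : ℕ} {e : SignedPoint n ≃ ZMod (2 * n)} {r s : Setoid (ZMod (2 * n))}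
  {c u v w : Hyperoctahedral n} {i j : SignedPoint n}

theorem mem_range_toCycle_iff (he : IsAntipodal e) {u : Equiv.Perm (ZMod (2 * n))} :
    u ∈ Set.range (toCycle e) ↔ Commute u (Equiv.addRight (n : ZMod (2 * n))) := by
  rw [commute_addRight_iff]
  constructor
  · rintro ⟨w, rfl⟩ x
    obtain ⟨x, rfl⟩ := e.surjective x
    rw [← he, toCycle_apply_apply, toCycle_apply_apply, Hyperoctahedral.apply_bar, he]
  · refine fun hu => ⟨⟨e.permCongrHom.symm u, fun x => ?_⟩, e.permCongrHom.apply_symm_apply u⟩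
    change e.symm (u (e (bar x))) = bar (e.symm (u (e x)))
    rw [e.symm_apply_eq, he, he, hu, e.apply_symm_apply]

variable [NeZero n]

/-- `v` corresponds to the permutation `nextPerm r` of the cycle, for a noncrossing equivalence
relation `r` invariant under the half turn. These are the elements of the noncrossing partition
lattice. -/
structure IsNextPerm (e : SignedPoint n ≃ ZMod (2 * n)) (r : Setoid (ZMod (2 * n)))
    (v : Hyperoctahedral n) : Prop where
  isNoncrossing : IsNoncrossing r
  isTranslationInvariant : IsTranslationInvariant (n : ZMod (2 * n)) r
  toCycle_eq : toCycle e v = nextPerm r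

theorem IsNextPerm.rel_toCycle (hv : IsNextPerm e r v) (x : ZMod (2 * n)) :
    r x (toCycle e v x) :=
  hv.toCycle_eq ▸ rel_next r x

theorem IsNextPerm.sameCycle_iff (hv : IsNextPerm e r v) :
    v.1.SameCycle i j ↔ r (e i) (e j) := by
  rw [← sameCycle_toCycle_iff (e := e), hv.toCycle_eq, sameCycle_nextPerm_iff]

theorem IsNextPerm.mul_signedSwap (he : IsAntipodal e) (hv : IsNextPerm e r v) (hij : i ≠ j)
    (hr : r (e i) (e j)) : IsNextPerm e (symCut r (e i) (e j)) (v * signedSwap i j) := by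
  refine ⟨isNoncrossing_symCut hv.isNoncrossing _ _,
    isTranslationInvariant_symCut hv.isTranslationInvariant _ _, ?_⟩
  have hne := e.injective.ne hij
  rw [map_mul, hv.toCycle_eq]
  by_cases hbar : j = bar i
  · subst hbar
    rw [toCycle_signedSwap_bar, hv.isNoncrossing.nextPerm_mul_swap hr hne, he, symCut_antipode]
  · rw [toCycle_signedSwap hbar, he, he,
      hv.isNoncrossing.nextPerm_mul_swap_mul_swap hv.isTranslationInvariant hr hne
        (he i ▸ e.injective.ne hbar)]

theorem rel_of_signedSwap_absLE (he : IsAntipodal e) (hr : IsNoncrossing r)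
    (hw : ∀ x, r x (toCycle e w x)) (hij : i ≠ j)
    (h : AbsLE (simpleReflections n) (signedSwap i j) w) : r (e i) (e j) := by
  have rel_of_sameCycle {x y} (hxy : w.1.SameCycle x y) : r (e x) (e y) :=
    rel_of_sameCycle hw (sameCycle_toCycle_iff.2 hxy)
  obtain h | ⟨hi, hj⟩ := sameCycle_or_balanced_of_signedSwap_absLE hij h
  · exact rel_of_sameCycle h
  · exact hr.rel_of_rel_antipode (he i ▸ rel_of_sameCycle hi) (he j ▸ rel_of_sameCycle hj)

theorem IsNextPerm.exists_of_absLE (he : IsAntipodal e) (hv : IsNextPerm e r v)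
    (huv : AbsLE (simpleReflections n) u v) : ∃ s, IsNextPerm e s u := by
  induction hk : absLength (simpleReflections n) v using Nat.strong_induction_on
    generalizing v r with
  | _ k ih =>
    obtain rfl | hne := eq_or_ne u v
    · exact ⟨r, hv⟩
    obtain ⟨t, ht, htv, hle, hlt⟩ := isReflectionRep_signedRep.exists_absLE_mul_reflection huv hne
    obtain ⟨i, j, hij, rfl⟩ := mem_reflections_iff.1 ht
    have hrel := rel_of_signedSwap_absLE he hv.isNoncrossing hv.rel_toCycle hij htv
    exact ih _ (hk ▸ hlt) (hv.mul_signedSwap he hij hrel) hle rfl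

theorem IsNextPerm.absLE (he : IsAntipodal e) (hu : IsNextPerm e r u) (hv : IsNextPerm e s v)
    (hrs : r ≤ s) : AbsLE (simpleReflections n) u v := by
  have hρ := isReflectionRep_signedRep (n := n)
  induction hk : absLength (simpleReflections n) v using Nat.strong_induction_on
    generalizing v s with
  | _ k ih =>
    obtain rfl | hne := eq_or_ne u v
    · exact hρ.absLE_refl u
    obtain ⟨a, ha⟩ : ∃ a, next r a ≠ next s a := by
      by_contra! h
      exact hne (toCycle_injective (by rw [hu.toCycle_eq, hv.toCycle_eq]; exact Equiv.ext h))
    obtain ⟨b, hb⟩ := (nextPerm s).surjective (next r a)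
    have hab : a ≠ b := by
      rintro rfl
      exact ha hb.symm
    have hsab : s a b := s.trans' (hrs (rel_next r a)) (s.symm' (hb ▸ rel_next s b))
    have hcut := hu.isNoncrossing.le_cut hv.isNoncrossing hrs hb hab
    obtain ⟨i, rfl⟩ := e.surjective a
    obtain ⟨j, rfl⟩ := e.surjective b
    have hij : i ≠ j := fun h => hab (h ▸ rfl)
    have ht := mem_reflections_iff.2 ⟨i, j, hij, rfl⟩
    have htv := signedSwap_absLE_of_sameCycle hij (hv.sameCycle_iff.2 hsab)
    have hlt := hρ.absLength_mul_reflection_lt ht ((hρ.reflection_absLE_iff ht).1 htv)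
    exact hρ.absLE_trans (ih _ (hk ▸ hlt) (hv.mul_signedSwap he hij hsab)
      (le_symCut hu.isTranslationInvariant hrs hcut) rfl) (hρ.mul_reflection_absLE ht htv)

theorem isNextPerm_top (hc : ∀ x, e (c.1 x) = e x + 1) : IsNextPerm e ⊤ c := by
  refine ⟨fun _ _ _ _ _ _ _ _ => trivial, fun _ _ => Iff.rfl, Equiv.ext fun x => ?_⟩
  obtain ⟨x, rfl⟩ := e.surjective x
  rw [toCycle_apply_apply, hc, nextPerm_eq_rot fun _ _ => trivial]
  rfl

theorem isNCJoin_of_toCycle_eq (he : IsAntipodal e) (hc : ∀ x, e (c.1 x) = e x + 1)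
    (hv : toCycle e v = nextPerm (ncOrbits (toCycle e w))) :
    IsNCJoin (simpleReflections n) c (reflectionsBelow (simpleReflections n) w) v := by
  have hvn : IsNextPerm e (ncOrbits (toCycle e w)) v := ⟨isNoncrossing_ncOrbits _,
    isTranslationInvariant_ncOrbits ((mem_range_toCycle_iff he).1 ⟨w, rfl⟩), hv⟩
  have hcn := isNextPerm_top hc
  refine ⟨⟨one_absLE v, hvn.absLE he hcn le_top⟩, ?_, ?_⟩
  · rintro t ⟨ht, htw⟩
    obtain ⟨i, j, hij, rfl⟩ := mem_reflections_iff.1 ht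
    exact signedSwap_absLE_of_sameCycle hij (hvn.sameCycle_iff.2
      (rel_of_signedSwap_absLE he (isNoncrossing_ncOrbits _) (rel_ncOrbits _) hij htw))
  · rintro u ⟨-, huc⟩ hub
    obtain ⟨s, hs⟩ := hcn.exists_of_absLE he huc
    refine hvn.absLE he hs (ncOrbits_le hs.isNoncrossing fun x => ?_)
    obtain ⟨x, rfl⟩ := e.surjective x
    rw [toCycle_apply_apply]
    by_cases hx : x = w.1 x
    · rw [← hx]
    · have hxw := signedSwap_absLE_of_sameCycle hx
        (Equiv.Perm.sameCycle_apply_right.2 (Equiv.Perm.SameCycle.refl w.1 x))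
      exact rel_of_signedSwap_absLE he hs.isNoncrossing hs.rel_toCycle hx
        (hub _ ⟨mem_reflections_iff.2 ⟨_, _, hx, rfl⟩, hxw⟩)

theorem toCycle_ncProj (he : IsAntipodal e) (hc : ∀ x, e (c.1 x) = e x + 1)
    (w : Hyperoctahedral n) :
    toCycle e (ncProj (simpleReflections n) c w) = nextPerm (ncOrbits (toCycle e w)) := by
  obtain ⟨v, hv⟩ := (mem_range_toCycle_iff he).2
    (isTranslationInvariant_ncOrbits ((mem_range_toCycle_iff he).1 ⟨w, rfl⟩)).commute_nextPerm
  rw [isReflectionRep_signedRep.ncProj_eq_of_isNCJoin (isNCJoin_of_toCycle_eq he hc hv), hv]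

theorem semiconj_toCycle (he : IsAntipodal e) (hc : ∀ x, e (c.1 x) = e x + 1) :
    Function.Semiconj (toCycle e) (popT (simpleReflections n) c) popCycle := fun w => by
  rw [popT, map_mul, map_inv, toCycle_ncProj he hc, popCycle]

theorem requiresExactly_iff (he : IsAntipodal e) (hc : ∀ x, e (c.1 x) = e x + 1) {k : ℕ} :
    RequiresExactly (simpleReflections n) c w k ↔
      IsLeast {m | popCycle^[m] (toCycle e w) = 1} k := by
  simp only [RequiresExactly, ← ((semiconj_toCycle he hc).iterate_right _).eq,
    map_eq_one_iff _ toCycle_injective]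

end Projection

section Count

variable {n : ℕ}

/-- The points of a cycle labelled by `±[n]` whose label has its absolute value in `B`. -/
def labelledBy (e : SignedPoint n ≃ ZMod (2 * n)) (B : Finset (Fin n)) : Set (ZMod (2 * n)) :=
  {x | (e.symm x).1 ∈ B}

variable {e : SignedPoint n ≃ ZMod (2 * n)}

theorem apply_mem_labelledBy_iff {B : Finset (Fin n)} {x : SignedPoint n} :
    e x ∈ labelledBy e B ↔ x.1 ∈ B := by
  simp [labelledBy]

theorem labelledBy_injective : Function.Injective (labelledBy e) := fun B C h => by
  ext i
  rw [← apply_mem_labelledBy_iff (e := e) (x := (i, true)), h, apply_mem_labelledBy_iff]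

theorem mem_range_labelledBy_iff (he : IsAntipodal e) {A : Set (ZMod (2 * n))} :
    A ∈ Set.range (labelledBy e) ↔ IsCentrallySymmetric A := by
  classical
  constructor
  · rintro ⟨B, rfl⟩ x
    obtain ⟨x, rfl⟩ := e.surjective x
    rw [← he, apply_mem_labelledBy_iff, apply_mem_labelledBy_iff]
    rfl
  · refine fun hA => ⟨Finset.univ.filter fun i => e (i, false) ∈ A, Set.ext fun x => ?_⟩
    obtain ⟨⟨i, b⟩, rfl⟩ := e.surjective x
    rw [apply_mem_labelledBy_iff, Finset.mem_filter_univ]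
    cases b
    · rfl
    · exact (hA _).symm.trans (he (i, false) ▸ Iff.rfl)

theorem labelledBy_singleton (he : IsAntipodal e) (x : SignedPoint n) :
    labelledBy e {x.1} = {e x, e x + (n : ZMod (2 * n))} := by
  ext y
  obtain ⟨y, rfl⟩ := e.surjective y
  rw [← he, apply_mem_labelledBy_iff, Finset.mem_singleton, Set.mem_insert_iff,
    Set.mem_singleton_iff, e.apply_eq_iff_eq, e.apply_eq_iff_eq]
  exact ⟨eq_or_eq_bar_of_fst_eq, by rintro (rfl | rfl) <;> rfl⟩

theorem card_eq_one_iff_labelledBy (he : IsAntipodal e) {B : Finset (Fin n)} :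
    B.card = 1 ↔ ∃ a, labelledBy e B = {a, a + (n : ZMod (2 * n))} := by
  rw [Finset.card_eq_one]
  constructor
  · rintro ⟨i, rfl⟩
    exact ⟨e (i, false), labelledBy_singleton he (i, false)⟩
  · rintro ⟨a, ha⟩
    obtain ⟨x, rfl⟩ := e.surjective a
    exact ⟨x.1, labelledBy_injective (ha.trans (labelledBy_singleton he x).symm)⟩

theorem ncard_setOf_card_ne_one (n : ℕ) :
    {B : Finset (Fin n) | B.card ≠ 1}.ncard = 2 ^ n - n := by
  have hcompl := Set.ncard_add_ncard_compl {B : Finset (Fin n) | B.card = 1}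
  have hone : {B : Finset (Fin n) | B.card = 1}.ncard = n := by
    rw [show {B : Finset (Fin n) | B.card = 1} = Set.range singleton by
      ext; simp [Finset.card_eq_one, eq_comm], ← Set.image_univ,
      Set.ncard_image_of_injective _ Finset.singleton_injective, Set.ncard_univ, Nat.card_fin]
  rw [hone, Nat.card_eq_fintype_card, Fintype.card_finset, Fintype.card_fin] at hcompl
  exact Nat.eq_sub_of_add_eq' hcompl

variable [NeZero n]

theorem slow_injOn : Set.InjOn slow {A : Set (ZMod (2 * n)) | IsCentrallySymmetric A} := by
  have support_eq {A : Set (ZMod (2 * n))} (hA : IsCentrallySymmetric A) :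
      {x | (rot * slow A : Equiv.Perm (ZMod (2 * n)))⁻¹ x ≠ x} = A := by
    rw [inv_rot_mul_slow]
    refine setOf_nextPerm_block_ne fun h => Set.eq_empty_of_forall_notMem fun a ha => ?_
    exact natCast_ne_zero_of_lt (NeZero.ne n) (by have := NeZero.pos n; lia)
      (add_eq_left.1 (h ((hA a).2 ha) ha))
  intro A hA B hB h
  rw [← support_eq hA, h, support_eq hB]

theorem ncard_slow (he : IsAntipodal e) :
    {w | ∃ A, IsCentrallySymmetric A ∧ (∀ a, A ≠ {a, a + (n : ZMod (2 * n))}) ∧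
      slow A = w}.ncard = 2 ^ n - n := by
  have himage : {w | ∃ A, IsCentrallySymmetric A ∧ (∀ a, A ≠ {a, a + (n : ZMod (2 * n))}) ∧
      slow A = w} = (slow ∘ labelledBy e) '' {B | B.card ≠ 1} := by
    ext w
    constructor
    · rintro ⟨A, hA, hpair, rfl⟩
      obtain ⟨B, rfl⟩ := (mem_range_labelledBy_iff he).2 hA
      exact ⟨B, fun hB => ((card_eq_one_iff_labelledBy he).1 hB).elim hpair, rfl⟩
    · rintro ⟨B, hB, rfl⟩
      exact ⟨_, (mem_range_labelledBy_iff he).1 ⟨B, rfl⟩,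
        fun a ha => hB ((card_eq_one_iff_labelledBy he).2 ⟨a, ha⟩), rfl⟩
  have hinj : Function.Injective (slow ∘ labelledBy e) := fun B C h =>
    labelledBy_injective (slow_injOn ((mem_range_labelledBy_iff he).1 ⟨B, rfl⟩)
      ((mem_range_labelledBy_iff he).1 ⟨C, rfl⟩) h)
  rw [himage, Set.ncard_image_of_injective _ hinj, ncard_setOf_card_ne_one]

end Count

end PopTsack

open PopTsack in
theorem mainTheorem5_general (n : ℕ) (hn : 2 ≤ n) (c : Hyperoctahedral n)
    (hc : ∀ x y, c.1.SameCycle x y) :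
    Set.ncard {w : Hyperoctahedral n |
      RequiresExactly (simpleReflections n) c w (2 * n - 2) ∨
        RequiresExactly (simpleReflections n) c w (2 * n - 1)} = 2 ^ n - n := by
  have : NeZero n := ⟨by lia⟩
  obtain ⟨e, hec, he⟩ := exists_equiv_zmod_two_mul hc
  rw [← ncard_slow he, ← Set.ncard_image_of_injective _ (toCycle_injective (e := e))]
  congr 1
  simp only [requiresExactly_iff he hec, isLeast_popCycle_iterate_eq_one_iff (by lia : 3 ≤ 2 * n)]
  ext u
  constructor
  · rintro ⟨w, hw, rfl⟩
    exact (popCycle_iterate_ne_one_iff hn ((mem_range_toCycle_iff he).1 ⟨w, rfl⟩)).1 hw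
  · rintro ⟨A, hA, hpair, rfl⟩
    have hcomm := commute_slow hA
    obtain ⟨w, hw⟩ := (mem_range_toCycle_iff he).2 hcomm
    refine ⟨w, ?_, hw⟩
    rw [Set.mem_ofPred_eq, hw]
    exact (popCycle_iterate_ne_one_iff hn hcomm).2 ⟨A, hA, hpair, rfl⟩

theorem mainTheorem5 (n : ℕ) (hn : 2 ≤ n) (c : PopTsack.Hyperoctahedral n)
    (hc : PopTsack.IsCoxeterElement c) :
    Set.ncard {w : PopTsack.Hyperoctahedral n |
      PopTsack.RequiresExactly (PopTsack.simpleReflections n) c w (2 * n - 2) ∨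
        PopTsack.RequiresExactly (PopTsack.simpleReflections n) c w (2 * n - 1)} = 2 ^ n - n :=
  mainTheorem5_general n hn c hc.sameCycle
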